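/- Let $\varphi\in\mathbb R$ be such that $q=e^{i\varphi}$ is not a root of unity, and put $q^{1/2}=e^{i\varphi/2}$. Let $\mathcal A=SL_q(2,\mathbb R)$ be the unital complex $*$-algebra generated by four self-adjoint elements $a,b,c,d$ with relations $$ab=q\,ba,\quad ac=q\,ca,\quad bc=cb,\quad bd=q\,db,\quad cd=q\,dc,\quad da-q^{-1}bc=1=ad-q\,bc,$$ with the Hopf algebra structure $$\Delta\begin{pmatrix}a&b\\c&d\end{pmatrix}=\begin{pmatrix}a&b\\c&d\end{pmatrix}\otimes\begin{pmatrix}a&b\\c&d\end{pmatrix},\quad \varepsilon\begin{pmatrix}a&b\\c&d\end{pmatrix}=\begin{pmatrix}1&0\\0&1\end{pmatrix},\quad S\begin{pmatrix}a&b\\c&d\end{pmatrix}=\begin{pmatrix}d&-q^{-1}b\\-q\,c&a\end{pmatrix},$$ and let $\tau=*\circ S$. For $\mu,\nu\in\mathbb R$ let $\mathcal C_{\mu\nu}$ be the linear span of $a-d+2q^{1/2}\mu\,b$ and $q\nu\,b+c$, let $\mathcal R_{\mu\nu}=\mathcal C_{\mu\nu}\mathcal A$ be the right ideal it generates (it is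 a $\tau$-invariant two-sided coideal), and let $\mathcal K_{\mu\nu}=\mathcal A/\mathcal R_{\mu\nu}$, with the induced coalgebra structure, right $\mathcal A$-module structure and antilinear map $\tau$. Let $\mathbf R_+$ and $\mathbf S^1$ denote the coalgebra $\mathbb C[z,z^{-1}]$ with all $z^n$ ($n\in\mathbb Z$) group-like, $S(z)=z^{-1}$, and the antilinear map $\tau=*\circ S$, where $z^*=z$ for $\mathbf R_+$ and $z^*=z^{-1}$ for $\mathbf S^1$ (so $\tau(z^n)=z^{-n}$, respectively $\tau(z^n)=z^n$). An isomorphism of real coalgebras is a complex coalgebra isomorphism that intertwines the maps $\tau$. Then: (i) If $\mu^2>\nu$, then $\mathcal K_{\mu\nu}$ is isomorphic to $\mathbf R_+$ as a real coalgebra. If $\nu>0$ and $\mu/\sqrt\nu=\cos\varphi_{\mu\nu}$ for a real $\varphi_{\mu\nu}$ with $\cos^2\varphi_{\mu\nu}\neq\cos^2(\ell\varphi)$ for all $\ell\in\mathbb Z$, then $\mathcal K_{\mu\nu}$ is isomorphic to $\mathbf S^1$ as a real coalgebra. Any two members of the special series, that is, any two $\mathcal K_{\mu\nu}$, $\mathcal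 K_{\mu'\nu'}$ with $\nu,\nu'>0$, $\mu/\sqrt\nu=\cos\varphi_{\mu\nu}$, $\mu'/\sqrt{\nu'}=\cos\varphi_{\mu'\nu'}$, $\cos^2\varphi_{\mu\nu}=\cos^2(\ell\varphi)$ and $\cos^2\varphi_{\mu'\nu'}=\cos^2(\ell'\varphi)$ for some $\ell,\ell'\in\mathbb Z$, are isomorphic as real coalgebras. (ii) If $\nu>0$, $\mu/\sqrt\nu=\cos\varphi_{\mu\nu}$ with $\varphi_{\mu\nu}\in\mathbb R$, $n\in\mathbb Z$ and $\mu_n/\sqrt\nu=\cos(\varphi_{\mu\nu}+n\varphi)$, then there is a linear isomorphism $\mathcal K_{\mu\nu}\to\mathcal K_{\mu_n\nu}$ that is at once an isomorphism of real coalgebras and of right $\mathcal A$-modules. -/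

import Mathlib

open scoped TensorProduct LaurentPolynomial ComplexConjugate

noncomputable section

namespace QuantumSL2

/-- The deformation parameter `q = e^{iφ}`, of modulus one. -/
def q (φ : ℝ) : ℂ := Complex.exp (φ * Complex.I)

/-- The square root `q^{1/2} = e^{iφ/2}` (replacing `φ` by `φ + 2π` gives the other root). -/
def qHalf (φ : ℝ) : ℂ := Complex.exp ((φ / 2 : ℝ) * Complex.I)

theorem q_ne_zero (φ : ℝ) : q φ ≠ 0 := Complex.exp_ne_zero _

theorem conj_q (φ : ℝ) : conj (q φ) = (q φ)⁻¹ := by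
  rw [q, ← Complex.exp_conj, ← Complex.exp_neg]; simp

theorem conj_q_inv (φ : ℝ) : conj ((q φ)⁻¹) = q φ := by
  rw [map_inv₀, conj_q, inv_inv]

theorem conj_qHalf (φ : ℝ) : conj (qHalf φ) = (qHalf φ)⁻¹ := by
  rw [qHalf, ← Complex.exp_conj, ← Complex.exp_neg, map_mul, Complex.conj_ofReal, Complex.conj_I,
    mul_neg]

theorem qHalf_mul_self (φ : ℝ) : qHalf φ * qHalf φ = q φ := by
  rw [qHalf, q, ← Complex.exp_add]; congr 1; push_cast; ring

theorem conj_qHalf_mul (φ : ℝ) : conj (qHalf φ) * q φ = qHalf φ := by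
  have h : qHalf φ ≠ 0 := Complex.exp_ne_zero _
  rw [conj_qHalf, ← qHalf_mul_self, ← mul_assoc, inv_mul_cancel₀ h, one_mul]

/-- The four generators. -/
inductive Gen
  | a | b | c | d

/-- The free unital complex algebra on the four generators. -/
abbrev Free := FreeAlgebra ℂ Gen

/-- A generator as an element of the free algebra. -/
abbrev gen (g : Gen) : Free := FreeAlgebra.ι ℂ g

/-- The defining relations. -/
inductive Rel (φ : ℝ) : Free → Free → Prop
  | ab : Rel φ (gen .a * gen .b) (q φ • (gen .b * gen .a))
  | ac : Rel φ (gen .a * gen .c) (q φ • (gen .c * gen .a))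
  | bc : Rel φ (gen .b * gen .c) (gen .c * gen .b)
  | bd : Rel φ (gen .b * gen .d) (q φ • (gen .d * gen .b))
  | cd : Rel φ (gen .c * gen .d) (q φ • (gen .d * gen .c))
  | da : Rel φ (gen .d * gen .a - (q φ)⁻¹ • (gen .b * gen .c)) 1
  | ad : Rel φ (gen .a * gen .d - q φ • (gen .b * gen .c)) 1

/-- The function algebra of `SL_q(2,ℝ)`, `q = e^{iφ}`. -/
def SLq (φ : ℝ) : Type := RingQuot (Rel φ)

namespace SLq

variable {φ : ℝ}

instance : Ring (SLq φ) := inferInstanceAs (Ring (RingQuot (Rel φ)))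
instance : Algebra ℂ (SLq φ) := inferInstanceAs (Algebra ℂ (RingQuot (Rel φ)))

/-- The quotient map from the free algebra. -/
def mk (φ : ℝ) : Free →ₐ[ℂ] SLq φ := RingQuot.mkAlgHom ℂ (Rel φ)

theorem mk_surjective : Function.Surjective (mk φ) := RingQuot.mkAlgHom_surjective ℂ (Rel φ)

theorem mk_rel {x y : Free} (h : Rel φ x y) : mk φ x = mk φ y := RingQuot.mkAlgHom_rel ℂ h

/-- The generator `a`. -/
def a (φ : ℝ) : SLq φ := mk φ (gen .a)
/-- The generator `b`. -/
def b (φ : ℝ) : SLq φ := mk φ (gen .b)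
/-- The generator `c`. -/
def c (φ : ℝ) : SLq φ := mk φ (gen .c)
/-- The generator `d`. -/
def d (φ : ℝ) : SLq φ := mk φ (gen .d)

theorem a_mul_b : a φ * b φ = q φ • (b φ * a φ) := by
  simpa [a, b, c, d] using mk_rel (φ := φ) .ab
theorem a_mul_c : a φ * c φ = q φ • (c φ * a φ) := by
  simpa [a, b, c, d] using mk_rel (φ := φ) .ac
theorem b_mul_c : b φ * c φ = c φ * b φ := by
  simpa [a, b, c, d] using mk_rel (φ := φ) .bc
theorem b_mul_d : b φ * d φ = q φ • (d φ * b φ) := by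
  simpa [a, b, c, d] using mk_rel (φ := φ) .bd
theorem c_mul_d : c φ * d φ = q φ • (d φ * c φ) := by
  simpa [a, b, c, d] using mk_rel (φ := φ) .cd
theorem d_mul_a : d φ * a φ = 1 + (q φ)⁻¹ • (b φ * c φ) := by
  rw [← sub_eq_iff_eq_add]; simpa [a, b, c, d] using mk_rel (φ := φ) .da
theorem a_mul_d : a φ * d φ = 1 + q φ • (b φ * c φ) := by
  rw [← sub_eq_iff_eq_add]; simpa [a, b, c, d] using mk_rel (φ := φ) .ad

/-- A quadruple of elements of a complex algebra satisfying the defining relations. -/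
structure Quad (φ : ℝ) {B : Type*} [Ring B] [Algebra ℂ B] (a b c d : B) : Prop where
  ab : a * b = q φ • (b * a)
  ac : a * c = q φ • (c * a)
  bc : b * c = c * b
  bd : b * d = q φ • (d * b)
  cd : c * d = q φ • (d * c)
  da : d * a = 1 + (q φ)⁻¹ • (b * c)
  ad : a * d = 1 + q φ • (b * c)

/-- The assignment of values to the generators. -/
def val {B : Type*} (a b c d : B) : Gen → B
  | .a => a
  | .b => b
  | .c => c
  | .d => d

/-- The universal property of `SL_q(2,ℝ)`. -/
def lift {B : Type*} [Ring B] [Algebra ℂ B] {a b c d : B} (h : Quad φ a b c d) :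
    SLq φ →ₐ[ℂ] B :=
  RingQuot.liftAlgHom ℂ ⟨FreeAlgebra.lift ℂ (val a b c d), by
    rintro _ _ (_ | _ | _ | _ | _ | _ | _)
    · simpa [val] using h.ab
    · simpa [val] using h.ac
    · simpa [val] using h.bc
    · simpa [val] using h.bd
    · simpa [val] using h.cd
    · simpa [val, sub_eq_iff_eq_add] using h.da
    · simpa [val, sub_eq_iff_eq_add] using h.ad⟩

section lift

variable {B : Type*} [Ring B] [Algebra ℂ B] {a' b' c' d' : B} (h : Quad φ a' b' c' d')

theorem lift_mk (x : Free) :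
    lift h (mk φ x) = FreeAlgebra.lift ℂ (val a' b' c' d') x :=
  RingQuot.liftAlgHom_mkAlgHom_apply _ _ _ _

@[simp] theorem lift_a : lift h (a φ) = a' := by rw [a, lift_mk]; simp [val]
@[simp] theorem lift_b : lift h (b φ) = b' := by rw [b, lift_mk]; simp [val]
@[simp] theorem lift_c : lift h (c φ) = c' := by rw [c, lift_mk]; simp [val]
@[simp] theorem lift_d : lift h (d φ) = d' := by rw [d, lift_mk]; simp [val]

end lift

@[elab_as_elim]
theorem induction {P : SLq φ → Prop} (halg : ∀ z : ℂ, P (algebraMap ℂ _ z))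
    (ha : P (a φ)) (hb : P (b φ)) (hc : P (c φ)) (hd : P (d φ))
    (hadd : ∀ x y, P x → P y → P (x + y)) (hmul : ∀ x y, P x → P y → P (x * y))
    (x : SLq φ) : P x := by
  obtain ⟨x, rfl⟩ := mk_surjective x
  induction x using FreeAlgebra.induction with
  | grade0 z => simpa using halg z
  | grade1 g => cases g <;> assumption
  | mul x y hx hy => rw [map_mul]; exact hmul _ _ hx hy
  | add x y hx hy => rw [map_add]; exact hadd _ _ hx hy

theorem algHom_ext {B : Type*} [Ring B] [Algebra ℂ B] {f g : SLq φ →ₐ[ℂ] B}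
    (ha : f (a φ) = g (a φ)) (hb : f (b φ) = g (b φ)) (hc : f (c φ) = g (c φ))
    (hd : f (d φ) = g (d φ)) : f = g := by
  ext x
  induction x using induction with
  | halg z => simp
  | ha => exact ha
  | hb => exact hb
  | hc => exact hc
  | hd => exact hd
  | hadd x y hx hy => rw [map_add, map_add, hx, hy]
  | hmul x y hx hy => rw [map_mul, map_mul, hx, hy]

theorem quad (φ : ℝ) : Quad φ (a φ) (b φ) (c φ) (d φ) :=
  ⟨a_mul_b, a_mul_c, b_mul_c, b_mul_d, c_mul_d, d_mul_a, a_mul_d⟩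

theorem comul_quad (φ : ℝ) : Quad φ
    (a φ ⊗ₜ[ℂ] a φ + b φ ⊗ₜ[ℂ] c φ) (a φ ⊗ₜ[ℂ] b φ + b φ ⊗ₜ[ℂ] d φ)
    (c φ ⊗ₜ[ℂ] a φ + d φ ⊗ₜ[ℂ] c φ) (c φ ⊗ₜ[ℂ] b φ + d φ ⊗ₜ[ℂ] d φ) := by
  have hq := q_ne_zero φ
  constructor <;>
  simp only [mul_add, add_mul, Algebra.TensorProduct.tmul_mul_tmul, a_mul_b, a_mul_c, b_mul_d,
    c_mul_d, d_mul_a, a_mul_d, b_mul_c, TensorProduct.tmul_smul, ← TensorProduct.smul_tmul',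
    TensorProduct.tmul_add, TensorProduct.add_tmul, Algebra.TensorProduct.one_def] <;>
  match_scalars <;> field_simp

theorem counit_quad (φ : ℝ) : Quad φ (1 : ℂ) 0 0 1 := by
  constructor <;> simp

theorem antipode_quad (φ : ℝ) : Quad φ (MulOpposite.op (d φ)) (MulOpposite.op (-(q φ)⁻¹ • b φ))
    (MulOpposite.op (-q φ • c φ)) (MulOpposite.op (a φ)) := by
  have hq := q_ne_zero φ
  constructor <;> apply MulOpposite.unop_injective <;>
  simp only [MulOpposite.unop_mul, MulOpposite.unop_op, MulOpposite.unop_smul,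
    MulOpposite.unop_add, MulOpposite.unop_one, smul_mul_assoc, mul_smul_comm, a_mul_b, a_mul_c,
    b_mul_d, c_mul_d, d_mul_a, a_mul_d, b_mul_c] <;>
  match_scalars <;> field_simp

/-- The bialgebra structure: `Δ` and `ε` are the algebra homomorphisms given on the matrix of
generators by matrix comultiplication and by the identity matrix. -/
instance : Bialgebra ℂ (SLq φ) :=
  Bialgebra.ofAlgHom (lift (comul_quad φ)) (lift (counit_quad φ))
    (by
      apply algHom_ext <;>
      simp [TensorProduct.add_tmul, TensorProduct.tmul_add] <;> abel)
    (by apply algHom_ext <;> simp)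
    (by apply algHom_ext <;> simp)

theorem comul_a : Coalgebra.comul (R := ℂ) (a φ) = a φ ⊗ₜ[ℂ] a φ + b φ ⊗ₜ[ℂ] c φ :=
  lift_a (comul_quad φ)
theorem comul_b : Coalgebra.comul (R := ℂ) (b φ) = a φ ⊗ₜ[ℂ] b φ + b φ ⊗ₜ[ℂ] d φ :=
  lift_b (comul_quad φ)
theorem comul_c : Coalgebra.comul (R := ℂ) (c φ) = c φ ⊗ₜ[ℂ] a φ + d φ ⊗ₜ[ℂ] c φ :=
  lift_c (comul_quad φ)
theorem comul_d : Coalgebra.comul (R := ℂ) (d φ) = c φ ⊗ₜ[ℂ] b φ + d φ ⊗ₜ[ℂ] d φ :=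
  lift_d (comul_quad φ)
theorem counit_a : Coalgebra.counit (R := ℂ) (a φ) = 1 := lift_a (counit_quad φ)
theorem counit_b : Coalgebra.counit (R := ℂ) (b φ) = 0 := lift_b (counit_quad φ)
theorem counit_c : Coalgebra.counit (R := ℂ) (c φ) = 0 := lift_c (counit_quad φ)
theorem counit_d : Coalgebra.counit (R := ℂ) (d φ) = 1 := lift_d (counit_quad φ)

/-- The antipode: the algebra antihomomorphism with
`a ↦ d`, `b ↦ -q⁻¹ b`, `c ↦ -q c`, `d ↦ a`. -/
def S (φ : ℝ) : SLq φ →ₗ[ℂ] SLq φ :=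
  (MulOpposite.opLinearEquiv ℂ).symm.toLinearMap ∘ₗ (lift (antipode_quad φ)).toLinearMap

theorem S_apply (x : SLq φ) : S φ x = (lift (antipode_quad φ) x).unop := rfl
theorem S_mul (x y : SLq φ) : S φ (x * y) = S φ y * S φ x := by simp [S_apply]
theorem S_algebraMap (z : ℂ) : S φ (algebraMap ℂ _ z) = algebraMap ℂ _ z := by simp [S_apply]
theorem S_one : S φ 1 = 1 := by simp [S_apply]
theorem S_a : S φ (a φ) = d φ := by simp [S_apply]
theorem S_b : S φ (b φ) = -(q φ)⁻¹ • b φ := by simp [S_apply]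
theorem S_c : S φ (c φ) = -q φ • c φ := by simp [S_apply]
theorem S_d : S φ (d φ) = a φ := by simp [S_apply]

theorem conv_left_mul (u : SLq φ ⊗[ℂ] SLq φ) (z : ℂ)
    (hu : LinearMap.mul' ℂ _ ((S φ).rTensor _ u) = algebraMap ℂ _ z) (v : SLq φ ⊗[ℂ] SLq φ) :
    LinearMap.mul' ℂ _ ((S φ).rTensor _ (u * v)) =
      z • LinearMap.mul' ℂ _ ((S φ).rTensor _ v) := by
  induction v with
  | zero => simp
  | add v w hv hw => rw [mul_add, map_add, map_add, hv, hw, map_add, map_add, smul_add]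
  | tmul y₁ y₂ =>
    have key : LinearMap.mul' ℂ _ ((S φ).rTensor _ (u * (y₁ ⊗ₜ[ℂ] y₂))) =
        S φ y₁ * LinearMap.mul' ℂ _ ((S φ).rTensor _ u) * y₂ := by
      clear hu
      induction u with
      | zero => simp
      | add u w hu hw => rw [add_mul, map_add, map_add, hu, hw, map_add, map_add, mul_add, add_mul]
      | tmul x₁ x₂ => simp [S_mul, mul_assoc]
    rw [key, hu]
    simp [Algebra.algebraMap_eq_smul_one]

theorem conv_right_mul (v : SLq φ ⊗[ℂ] SLq φ) (z : ℂ)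
    (hv : LinearMap.mul' ℂ _ ((S φ).lTensor _ v) = algebraMap ℂ _ z) (u : SLq φ ⊗[ℂ] SLq φ) :
    LinearMap.mul' ℂ _ ((S φ).lTensor _ (u * v)) =
      z • LinearMap.mul' ℂ _ ((S φ).lTensor _ u) := by
  induction u with
  | zero => simp
  | add u w hu hw => rw [add_mul, map_add, map_add, hu, hw, map_add, map_add, smul_add]
  | tmul x₁ x₂ =>
    have key : LinearMap.mul' ℂ _ ((S φ).lTensor _ ((x₁ ⊗ₜ[ℂ] x₂) * v)) =
        x₁ * LinearMap.mul' ℂ _ ((S φ).lTensor _ v) * S φ x₂ := by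
      clear hv
      induction v with
      | zero => simp
      | add u w hu hw => rw [mul_add, map_add, map_add, hu, hw, map_add, map_add, mul_add, add_mul]
      | tmul x₁ x₂ => simp [S_mul, mul_assoc]
    rw [key, hv]
    simp [Algebra.algebraMap_eq_smul_one]

/-- The Hopf algebra structure. -/
instance : HopfAlgebra ℂ (SLq φ) where
  antipode := S φ
  mul_antipode_rTensor_comul := by
    have hq := q_ne_zero φ
    ext x
    simp only [LinearMap.comp_apply, Algebra.linearMap_apply]
    induction x using induction with
    | halg z => simp [Algebra.TensorProduct.algebraMap_apply, S_algebraMap]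
    | ha =>
      simp [comul_a, counit_a, S_a, S_b, d_mul_a]
    | hb =>
      simp [comul_b, counit_b, S_a, S_b, b_mul_d, smul_smul, hq]
    | hc =>
      simp [comul_c, counit_c, S_c, S_d, a_mul_c]
    | hd =>
      simp [comul_d, counit_d, S_c, S_d, a_mul_d, b_mul_c]
    | hadd x y hx hy => simp only [map_add, hx, hy]
    | hmul x y hx hy =>
      rw [Bialgebra.comul_mul, conv_left_mul _ _ hx, hy, Bialgebra.counit_mul, map_mul,
        Algebra.smul_def]
  mul_antipode_lTensor_comul := by
    have hq := q_ne_zero φ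
    ext x
    simp only [LinearMap.comp_apply, Algebra.linearMap_apply]
    induction x using induction with
    | halg z => simp [Algebra.TensorProduct.algebraMap_apply, S_one]
    | ha =>
      simp [comul_a, counit_a, S_a, S_c, a_mul_d]
    | hb =>
      simp [comul_b, counit_b, S_d, S_b, a_mul_b, smul_smul, hq]
    | hc =>
      simp [comul_c, counit_c, S_c, S_a, c_mul_d]
    | hd =>
      simp [comul_d, counit_d, S_b, S_d, d_mul_a, b_mul_c]
    | hadd x y hx hy => simp only [map_add, hx, hy]
    | hmul x y hx hy =>
      rw [Bialgebra.comul_mul, conv_right_mul _ _ hy, hx, Bialgebra.counit_mul, map_mul,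
        Algebra.smul_def, Algebra.commutes]

theorem antipode_eq (x : SLq φ) : HopfAlgebra.antipode ℂ x = S φ x := rfl

/-- The opposite algebra of `SL_q(2,ℝ)` with the complex conjugate scalar multiplication. -/
def ConjOp (φ : ℝ) : Type := (SLq φ)ᵐᵒᵖ

instance : Ring (ConjOp φ) := inferInstanceAs (Ring (SLq φ)ᵐᵒᵖ)

instance : Algebra ℂ (ConjOp φ) :=
  RingHom.toAlgebra' ((algebraMap ℂ (SLq φ)ᵐᵒᵖ).comp (starRingEnd ℂ))
    fun z x => Algebra.commutes (A := (SLq φ)ᵐᵒᵖ) (conj z) x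

/-- Passing to the opposite algebra. -/
def conjOp (x : SLq φ) : ConjOp φ := MulOpposite.op x

theorem smul_conjOp (z : ℂ) (x : SLq φ) : z • conjOp x = conjOp (conj z • x) := by
  rw [Algebra.smul_def, Algebra.smul_def, Algebra.commutes]; rfl

theorem conjOp_mul (x y : SLq φ) : conjOp x * conjOp y = conjOp (y * x) := rfl

theorem star_quad (φ : ℝ) :
    Quad φ (conjOp (a φ)) (conjOp (b φ)) (conjOp (c φ)) (conjOp (d φ)) := by
  have hq := q_ne_zero φ
  constructor
  · rw [conjOp_mul, conjOp_mul, smul_conjOp, a_mul_b, conj_q, smul_smul, inv_mul_cancel₀ hq,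
      one_smul]
  · rw [conjOp_mul, conjOp_mul, smul_conjOp, a_mul_c, conj_q, smul_smul, inv_mul_cancel₀ hq,
      one_smul]
  · rw [conjOp_mul, conjOp_mul, b_mul_c]
  · rw [conjOp_mul, conjOp_mul, smul_conjOp, b_mul_d, conj_q, smul_smul, inv_mul_cancel₀ hq,
      one_smul]
  · rw [conjOp_mul, conjOp_mul, smul_conjOp, c_mul_d, conj_q, smul_smul, inv_mul_cancel₀ hq,
      one_smul]
  · rw [conjOp_mul, conjOp_mul, smul_conjOp, a_mul_d, conj_q_inv, ← b_mul_c]; rfl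
  · rw [conjOp_mul, conjOp_mul, smul_conjOp, d_mul_a, conj_q, ← b_mul_c]; rfl

/-- The involution: the antilinear antihomomorphism fixing the four generators. -/
instance : Star (SLq φ) where
  star x := MulOpposite.unop (α := SLq φ) (lift (star_quad φ) x)

theorem star_def (x : SLq φ) : star x = MulOpposite.unop (α := SLq φ) (lift (star_quad φ) x) := rfl
theorem star_a : star (a φ) = a φ := by rw [star_def, lift_a]; rfl
theorem star_b : star (b φ) = b φ := by rw [star_def, lift_b]; rfl
theorem star_c : star (c φ) = c φ := by rw [star_def, lift_c]; rfl
theorem star_d : star (d φ) = d φ := by rw [star_def, lift_d]; rfl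
theorem star_mul' (x y : SLq φ) : star (x * y) = star y * star x := by
  rw [star_def, map_mul]; rfl
theorem star_add' (x y : SLq φ) : star (x + y) = star x + star y := by
  rw [star_def, map_add]; rfl
theorem star_algebraMap (z : ℂ) : star (algebraMap ℂ (SLq φ) z) = algebraMap ℂ _ (conj z) := by
  rw [star_def, AlgHom.commutes]; rfl

instance : StarRing (SLq φ) where
  star_involutive x := by
    induction x using induction with
    | halg z => simp [star_algebraMap]
    | ha => simp [star_a]
    | hb => simp [star_b]
    | hc => simp [star_c]
    | hd => simp [star_d]
    | hadd x y hx hy => rw [star_add', star_add', hx, hy]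
    | hmul x y hx hy => rw [star_mul', star_mul', hx, hy]
  star_mul := star_mul'
  star_add := star_add'

instance : StarModule ℂ (SLq φ) where
  star_smul z x := by
    rw [Algebra.smul_def, star_mul', star_algebraMap, Algebra.smul_def, Algebra.commutes]; rfl

/-- The antilinear map `τ = * ∘ S`. -/
def τ (φ : ℝ) : SLq φ →ₛₗ[starRingEnd ℂ] SLq φ where
  toFun x := star (HopfAlgebra.antipode ℂ x)
  map_add' x y := by rw [map_add, star_add]
  map_smul' z x := by rw [map_smul, star_smul]; rfl

theorem τ_apply (x : SLq φ) : τ φ x = star (HopfAlgebra.antipode ℂ x) := rfl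

theorem τ_mul (x y : SLq φ) : τ φ (x * y) = τ φ x * τ φ y := by
  rw [τ_apply, antipode_eq, S_mul, star_mul]; rfl

theorem τ_a : τ φ (a φ) = d φ := by rw [τ_apply, antipode_eq, S_a, star_d]
theorem τ_d : τ φ (d φ) = a φ := by rw [τ_apply, antipode_eq, S_d, star_a]
theorem τ_b : τ φ (b φ) = -q φ • b φ := by
  rw [τ_apply, antipode_eq, S_b, star_smul, star_b, star_neg, ← starRingEnd_apply, conj_q_inv]
theorem τ_c : τ φ (c φ) = -(q φ)⁻¹ • c φ := by
  rw [τ_apply, antipode_eq, S_c, star_smul, star_c, star_neg, ← starRingEnd_apply, conj_q]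

end SLq

open SLq

variable (φ μ ν : ℝ)

/-- The element `a - d + 2 q^{1/2} μ b`. -/
def coidealGen₁ : SLq φ := a φ - d φ + (2 * qHalf φ * μ) • b φ

/-- The element `q ν b + c`. -/
def coidealGen₂ : SLq φ := (q φ * ν) • b φ + c φ

/-- The subspace `C_{μν}` spanned by `a - d + 2 q^{1/2} μ b` and `q ν b + c`. -/
def C : Submodule ℂ (SLq φ) := Submodule.span ℂ {coidealGen₁ φ μ, coidealGen₂ φ ν}

/-- The right ideal `R_{μν} = C_{μν} · SL_q(2,ℝ)`; right modules are modules over the opposite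
algebra. -/
def R : Submodule (SLq φ)ᵐᵒᵖ (SLq φ) := Submodule.span (SLq φ)ᵐᵒᵖ (C φ μ ν : Set (SLq φ))

/-- The right ideal `R_{μν}` as a complex subspace. -/
abbrev Rℂ : Submodule ℂ (SLq φ) := (R φ μ ν).restrictScalars ℂ

variable {φ μ ν}

theorem mem_R_mul {x : SLq φ} (hx : x ∈ R φ μ ν) (y : SLq φ) : x * y ∈ R φ μ ν :=
  (R φ μ ν).smul_mem (MulOpposite.op y) hx

theorem gen₁_mem : coidealGen₁ φ μ ∈ R φ μ ν :=
  Submodule.subset_span (Submodule.subset_span (by simp))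

theorem gen₂_mem : coidealGen₂ φ ν ∈ R φ μ ν :=
  Submodule.subset_span (Submodule.subset_span (by simp))

/-- To check a property on `R_{μν}` it suffices to check it on `x · y`, `x` one of the two
generators. -/
theorem R_induction {P : SLq φ → Prop} (h0 : P 0) (hadd : ∀ x y, P x → P y → P (x + y))
    (h₁ : ∀ y, P (coidealGen₁ φ μ * y)) (h₂ : ∀ y, P (coidealGen₂ φ ν * y))
    {x : SLq φ} (hx : x ∈ R φ μ ν) : P x := by
  have hC : ∀ x ∈ C φ μ ν, ∀ y, P (x * y) := by
    intro x hx
    induction hx using Submodule.span_induction with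
    | mem x hx =>
      rcases hx with rfl | rfl
      · exact h₁
      · exact h₂
    | zero => intro y; simpa using h0
    | add x x' _ _ hx hx' => intro y; rw [add_mul]; exact hadd _ _ (hx y) (hx' y)
    | smul z x _ hx => intro y; rw [smul_mul_assoc, ← mul_smul_comm]; exact hx _
  have : ∀ y, P (x * y) := by
    induction hx using Submodule.span_induction with
    | mem x hx => exact hC x hx
    | zero => intro y; simpa using h0
    | add x x' _ _ hx hx' => intro y; rw [add_mul]; exact hadd _ _ (hx y) (hx' y)
    | smul z x _ hx =>
      intro y
      rw [MulOpposite.smul_eq_mul_unop, mul_assoc]; exact hx _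
  simpa using this 1

theorem map_mkQ_mul {u : SLq φ ⊗[ℂ] SLq φ}
    (hu : TensorProduct.map (Rℂ φ μ ν).mkQ (Rℂ φ μ ν).mkQ u = 0) (v : SLq φ ⊗[ℂ] SLq φ) :
    TensorProduct.map (Rℂ φ μ ν).mkQ (Rℂ φ μ ν).mkQ (u * v) = 0 := by
  induction v with
  | zero => simp
  | add v w hv hw => rw [mul_add, map_add, hv, hw, add_zero]
  | tmul y₁ y₂ =>
    have key : ∀ u : SLq φ ⊗[ℂ] SLq φ,
        TensorProduct.map (Rℂ φ μ ν).mkQ (Rℂ φ μ ν).mkQ (u * y₁ ⊗ₜ[ℂ] y₂) =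
        TensorProduct.map
          ((Rℂ φ μ ν).mapQ (Rℂ φ μ ν) (LinearMap.mulRight ℂ y₁) fun x hx => mem_R_mul hx y₁)
          ((Rℂ φ μ ν).mapQ (Rℂ φ μ ν) (LinearMap.mulRight ℂ y₂) fun x hx => mem_R_mul hx y₂)
          (TensorProduct.map (Rℂ φ μ ν).mkQ (Rℂ φ μ ν).mkQ u) := by
      intro u
      induction u with
      | zero => simp
      | add u w hu hw => rw [add_mul, map_add, hu, hw, map_add, map_add]
      | tmul x₁ x₂ =>
        rw [Algebra.TensorProduct.tmul_mul_tmul]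
        simp only [TensorProduct.map_tmul]
        rfl
    rw [key, hu, map_zero]

theorem comul_gen₁ : Coalgebra.comul (R := ℂ) (coidealGen₁ φ μ) =
    coidealGen₁ φ μ ⊗ₜ[ℂ] (a φ + (2 * qHalf φ * μ) • b φ) +
    (d φ - (2 * qHalf φ * μ) • b φ) ⊗ₜ[ℂ] coidealGen₁ φ μ +
    b φ ⊗ₜ[ℂ] coidealGen₂ φ ν - coidealGen₂ φ ν ⊗ₜ[ℂ] b φ := by
  simp only [coidealGen₁, coidealGen₂, map_add, map_sub, map_smul, comul_a, comul_b, comul_d,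
    TensorProduct.tmul_add, TensorProduct.add_tmul, TensorProduct.tmul_sub, TensorProduct.sub_tmul,
    TensorProduct.tmul_smul, ← TensorProduct.smul_tmul']
  module

theorem comul_gen₂ : Coalgebra.comul (R := ℂ) (coidealGen₂ φ ν) =
    (a φ + (2 * qHalf φ * μ) • b φ) ⊗ₜ[ℂ] coidealGen₂ φ ν +
    coidealGen₂ φ ν ⊗ₜ[ℂ] (d φ - (2 * qHalf φ * μ) • b φ) -
    coidealGen₁ φ μ ⊗ₜ[ℂ] c φ + c φ ⊗ₜ[ℂ] coidealGen₁ φ μ := by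
  simp only [coidealGen₁, coidealGen₂, map_add, map_smul, comul_c, comul_b,
    TensorProduct.tmul_add, TensorProduct.add_tmul, TensorProduct.tmul_sub, TensorProduct.sub_tmul,
    TensorProduct.tmul_smul, ← TensorProduct.smul_tmul']
  module

theorem counit_gen₁ : Coalgebra.counit (R := ℂ) (coidealGen₁ φ μ) = 0 := by
  simp [coidealGen₁, counit_a, counit_b, counit_d]

theorem counit_gen₂ : Coalgebra.counit (R := ℂ) (coidealGen₂ φ ν) = 0 := by
  simp [coidealGen₂, counit_b, counit_c]

theorem mkQ_gen₁ : (Rℂ φ μ ν).mkQ (coidealGen₁ φ μ) = 0 := by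
  simpa using gen₁_mem

theorem mkQ_gen₂ : (Rℂ φ μ ν).mkQ (coidealGen₂ φ ν) = 0 := by
  simpa using gen₂_mem

/-- `R_{μν}` is a two-sided coideal. -/
instance : (Rℂ φ μ ν).IsCoideal where
  counit_eq_zero x hx := by
    refine R_induction (μ := μ) (ν := ν) (P := fun x => Coalgebra.counit (R := ℂ) x = 0)
      ?_ ?_ ?_ ?_ hx
    · simp
    · intro x y hx hy; rw [map_add, hx, hy, add_zero]
    · intro y; rw [Bialgebra.counit_mul, counit_gen₁, zero_mul]
    · intro y; rw [Bialgebra.counit_mul, counit_gen₂, zero_mul]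
  map_mkQ_comul_eq_zero x hx := by
    refine R_induction (μ := μ) (ν := ν) (P := fun x =>
      TensorProduct.map (Rℂ φ μ ν).mkQ (Rℂ φ μ ν).mkQ (Coalgebra.comul x) = 0) ?_ ?_ ?_ ?_ hx
    · simp
    · intro x y hx hy; rw [map_add, map_add, hx, hy, add_zero]
    · intro y
      rw [Bialgebra.comul_mul]
      refine map_mkQ_mul ?_ _
      rw [comul_gen₁ (ν := ν)]
      simp only [map_add, map_sub, TensorProduct.map_tmul, mkQ_gen₁, mkQ_gen₂,
        TensorProduct.zero_tmul, TensorProduct.tmul_zero, add_zero, sub_zero]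
    · intro y
      rw [Bialgebra.comul_mul]
      refine map_mkQ_mul ?_ _
      rw [comul_gen₂ (μ := μ)]
      simp only [map_add, map_sub, TensorProduct.map_tmul, mkQ_gen₁, mkQ_gen₂,
        TensorProduct.zero_tmul, TensorProduct.tmul_zero, add_zero, sub_zero]

theorem τ_gen₁ : τ φ (coidealGen₁ φ μ) = -coidealGen₁ φ μ := by
  have h := conj_qHalf_mul φ
  simp only [coidealGen₁, map_add, map_sub, LinearMap.map_smulₛₗ, τ_a, τ_b, τ_d, map_mul,
    Complex.conj_ofReal, map_ofNat, smul_smul]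
  rw [show 2 * conj (qHalf φ) * (μ : ℂ) * -q φ = -(2 * (conj (qHalf φ) * q φ) * μ) by ring, h]
  module

theorem τ_gen₂ : τ φ (coidealGen₂ φ ν) = -(q φ)⁻¹ • coidealGen₂ φ ν := by
  have hq := q_ne_zero φ
  simp only [coidealGen₂, map_add, LinearMap.map_smulₛₗ, τ_b, τ_c, map_mul, Complex.conj_ofReal,
    conj_q, smul_smul]
  match_scalars <;> field_simp

theorem τ_mem_R {x : SLq φ} (hx : x ∈ R φ μ ν) : τ φ x ∈ R φ μ ν := by
  refine R_induction (μ := μ) (ν := ν) (P := fun x => τ φ x ∈ R φ μ ν) ?_ ?_ ?_ ?_ hx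
  · simp
  · intro x y hx hy; rw [map_add]; exact add_mem hx hy
  · intro y
    rw [τ_mul, τ_gen₁]
    exact mem_R_mul (neg_mem gen₁_mem) _
  · intro y
    rw [τ_mul, τ_gen₂, smul_mul_assoc]
    exact (Rℂ φ μ ν).smul_mem _ (mem_R_mul gen₂_mem _)

variable (φ μ ν)

/-- The coisotropic subgroup `K_{μν} = SL_q(2,ℝ) / R_{μν}`. -/
def K : Type := SLq φ ⧸ Rℂ φ μ ν

instance : AddCommGroup (K φ μ ν) := inferInstanceAs (AddCommGroup (SLq φ ⧸ Rℂ φ μ ν))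

instance : Module ℂ (K φ μ ν) := inferInstanceAs (Module ℂ (SLq φ ⧸ Rℂ φ μ ν))

/-- The coalgebra structure induced from `SL_q(2,ℝ)`. -/
instance : Coalgebra ℂ (K φ μ ν) := inferInstanceAs (Coalgebra ℂ (SLq φ ⧸ Rℂ φ μ ν))

/-- The right `SL_q(2,ℝ)`-module structure induced by multiplication. -/
instance : Module (SLq φ)ᵐᵒᵖ (K φ μ ν) := inferInstanceAs (Module (SLq φ)ᵐᵒᵖ (SLq φ ⧸ R φ μ ν))

/-- The quotient map `r_{μν}`. -/
def r : SLq φ →ₗ[ℂ] K φ μ ν := (Rℂ φ μ ν).mkQ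

/-- The antilinear map `τ_K` on `K_{μν}` with `τ_K ∘ r_{μν} = r_{μν} ∘ τ`. -/
def τK : K φ μ ν →ₛₗ[starRingEnd ℂ] K φ μ ν :=
  (Rℂ φ μ ν).mapQ (Rℂ φ μ ν) (τ φ) fun _ hx => τ_mem_R hx

theorem r_surjective : Function.Surjective (r φ μ ν) := (Rℂ φ μ ν).mkQ_surjective

theorem comul_r (x : SLq φ) : Coalgebra.comul (R := ℂ) (r φ μ ν x) =
    TensorProduct.map (r φ μ ν) (r φ μ ν) (Coalgebra.comul x) :=
  Coalgebra.Quotient.comul_mk (Rℂ φ μ ν) x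

theorem counit_r (x : SLq φ) : Coalgebra.counit (R := ℂ) (r φ μ ν x) = Coalgebra.counit x :=
  Coalgebra.Quotient.counit_mk (Rℂ φ μ ν) x

theorem op_smul_r (x y : SLq φ) : MulOpposite.op y • r φ μ ν x = r φ μ ν (x * y) := rfl

theorem τK_r (x : SLq φ) : τK φ μ ν (r φ μ ν x) = r φ μ ν (τ φ x) := rfl

variable {φ μ ν}

/-- The involution of the coordinate Hopf algebra `ℂ[λ,λ⁻¹]` of `ℝ_+`: antilinear, `λ* = λ`. -/
def starRPlus (f : ℂ[T;T⁻¹]) : ℂ[T;T⁻¹] := AddMonoidAlgebra.mapRingHom ℤ (starRingEnd ℂ) f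

/-- The involution of the coordinate Hopf algebra `ℂ[z,z⁻¹]` of `S¹`: antilinear, `z* = z⁻¹`. -/
def starS1 (f : ℂ[T;T⁻¹]) : ℂ[T;T⁻¹] :=
  LaurentPolynomial.invert (AddMonoidAlgebra.mapRingHom ℤ (starRingEnd ℂ) f)

/-- `τ = * ∘ S` for `ℝ_+`. -/
def τRPlus (f : ℂ[T;T⁻¹]) : ℂ[T;T⁻¹] := starRPlus (HopfAlgebra.antipode ℂ f)

/-- `τ = * ∘ S` for `S¹`. -/
def τS1 (f : ℂ[T;T⁻¹]) : ℂ[T;T⁻¹] := starS1 (HopfAlgebra.antipode ℂ f)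

/-- Isomorphism of real coalgebras `(A, σ)`, `(B, ρ)`: a complex coalgebra isomorphism that
intertwines the antilinear maps `σ` and `ρ`. -/
def RealCoalgIso {A B : Type*} [AddCommGroup A] [Module ℂ A] [Coalgebra ℂ A] [AddCommGroup B]
    [Module ℂ B] [Coalgebra ℂ B] (σ : A → A) (ρ : B → B) : Prop :=
  ∃ e : A ≃ₗc[ℂ] B, ∀ x, e (σ x) = ρ (e x)

end QuantumSL2

end

noncomputable section

namespace QuantumSL2

open SLq

/-! Factor the parameters as `s + t = 2μ`, `s t = ν`. The class of `1` in `K_{μν}` is a cyclic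
group-like vector of weight `(s, t)` in the sense of `IsWeight`. Acting on a weight vector by `a +
q^{1/2} s b` changes its weight to `(q s, q⁻¹ t)`, keeps it group-like, and is undone by acting with
`a + q^{1/2} q⁻¹ t b` (`IsWeight.shift_left`, `IsWeight.isGroupLikeElem_shift`,
`IsWeight.shift_shift`). Everything follows from these moves.

For (ii), take `s = √ν e^{iθ}` and `t` its conjugate. A shifted vector satisfies the relations
defining the neighbouring quotient, so it is the image of `1` under a right module map.
Group-likeness makes this map one of coalgebras, τ-invariance of the vector makes it real, and the
reverse shift inverts it. Each move replaces `θ` by `θ ± φ`. The special series is thereby reduced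
to `cos θ = ±1`, and the rescaling `b ↦ t b`, `c ↦ t⁻¹ c` with real `t` of either sign carries all
its members to `K_{11}`.

For the generic types, iterate the shifts in both directions to get a ladder `g n` through the class
of `1`. If `qⁿ s ≠ q⁻ⁿ t` for all `n`, the ladder is a basis: it spans because the difference of the
two shifts recovers `b` (`IsLadder.span_eq_top`), and it is independent because an explicit
representation on functions on `ℤ` supplies dual functionals (`IsLadder.functional_apply`). A basis
of group-likes indexed by `ℤ` is the coalgebra of Laurent polynomials. The real form is read off
from τ on the ladder: conjugate `s, t` give `g n ↦ g n`, the circle; real `s, t` give `g n ↦ g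
(-n)`, the half-line. -/

theorem qHalf_ne_zero (φ : ℝ) : qHalf φ ≠ 0 := Complex.exp_ne_zero _

theorem conj_q_zpow (φ : ℝ) (n : ℤ) : conj (q φ ^ n) = q φ ^ (-n) := by
  rw [map_zpow₀, conj_q, inv_zpow']

/-! ### The right action on the quotient and its compatibility with the coalgebra structure and τ -/

section Action

variable {φ μ ν : ℝ}

/-- The right action of `SL_q(2,ℝ)` on `K_{μν}`, as a family of complex linear maps. -/
def act : SLq φ →ₗ[ℂ] Module.End ℂ (K φ μ ν) where
  toFun y :=
    { toFun := fun v => MulOpposite.op y • v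
      map_add' := fun v w => smul_add _ v w
      map_smul' := fun z v => by
        obtain ⟨x, rfl⟩ := r_surjective φ μ ν v
        rw [← map_smul, op_smul_r, op_smul_r, smul_mul_assoc, map_smul]; rfl }
  map_add' y y' := by
    ext v
    exact add_smul (MulOpposite.op y) (MulOpposite.op y') v
  map_smul' z y := by
    ext v
    obtain ⟨x, rfl⟩ := r_surjective φ μ ν v
    change MulOpposite.op (z • y) • r φ μ ν x = z • MulOpposite.op y • r φ μ ν x
    rw [op_smul_r, op_smul_r, mul_smul_comm, map_smul]

theorem act_r (y x : SLq φ) : act y (r φ μ ν x) = r φ μ ν (x * y) := rfl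

theorem act_mul (y z : SLq φ) (v : K φ μ ν) : act (y * z) v = act z (act y v) := by
  obtain ⟨x, rfl⟩ := r_surjective φ μ ν v
  rw [act_r, act_r, act_r, mul_assoc]

theorem act_one (v : K φ μ ν) : act 1 v = v := by
  obtain ⟨x, rfl⟩ := r_surjective φ μ ν v
  rw [act_r, mul_one]

theorem act_add (y z : SLq φ) (v : K φ μ ν) : act (y + z) v = act y v + act z v := by
  rw [map_add]; rfl

theorem act_smul (w : ℂ) (y : SLq φ) (v : K φ μ ν) : act (w • y) v = w • act y v := by
  rw [map_smul]; rfl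

theorem r_eq_act (x : SLq φ) : r φ μ ν x = act x (r φ μ ν 1) := by rw [act_r, one_mul]

theorem τK_act (y : SLq φ) (v : K φ μ ν) :
    τK φ μ ν (act y v) = act (τ φ y) (τK φ μ ν v) := by
  obtain ⟨x, rfl⟩ := r_surjective φ μ ν v
  rw [act_r, τK_r, τK_r, act_r, τ_mul]

variable (φ μ ν) in
/-- The componentwise right action of `SL_q(2,ℝ) ⊗ SL_q(2,ℝ)` on `K_{μν} ⊗ K_{μν}`. -/
def actTensor : SLq φ ⊗[ℂ] SLq φ →ₗ[ℂ] Module.End ℂ (K φ μ ν ⊗[ℂ] K φ μ ν) :=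
  TensorProduct.homTensorHomMap (.id ℂ) _ _ _ _ ∘ₗ TensorProduct.map act act

@[simp] theorem actTensor_tmul (y z : SLq φ) (v w : K φ μ ν) :
    actTensor φ μ ν (y ⊗ₜ z) (v ⊗ₜ w) = act y v ⊗ₜ[ℂ] act z w := rfl

/-- The comultiplication of the algebra is multiplicative and descends to the quotient, which makes
the quotient a module coalgebra. -/
theorem comul_act (y : SLq φ) (v : K φ μ ν) :
    Coalgebra.comul (R := ℂ) (act y v) =
      actTensor φ μ ν (Coalgebra.comul y) (Coalgebra.comul v) := by
  have key (u w : SLq φ ⊗[ℂ] SLq φ) : TensorProduct.map (r φ μ ν) (r φ μ ν) (u * w) =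
      actTensor φ μ ν w (TensorProduct.map (r φ μ ν) (r φ μ ν) u) := by
    induction w with
    | zero => simp
    | add w w' hw hw' => rw [mul_add, map_add, hw, hw', map_add, LinearMap.add_apply]
    | tmul y z =>
      induction u with
      | zero => simp
      | add u u' hu hu' => rw [add_mul, map_add, hu, hu', map_add, map_add]
      | tmul x x' =>
        rw [Algebra.TensorProduct.tmul_mul_tmul, TensorProduct.map_tmul, TensorProduct.map_tmul,
          actTensor_tmul, act_r, act_r]
  obtain ⟨x, rfl⟩ := r_surjective φ μ ν v
  rw [act_r, comul_r, Bialgebra.comul_mul, key, comul_r]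

theorem counit_act (y : SLq φ) (v : K φ μ ν) :
    Coalgebra.counit (R := ℂ) (act y v) = Coalgebra.counit (R := ℂ) v * Coalgebra.counit y := by
  obtain ⟨x, rfl⟩ := r_surjective φ μ ν v
  rw [act_r, counit_r, Bialgebra.counit_mul, counit_r]

end Action

/-! ### Weight vectors and the shift operators -/

section Weight

variable {φ μ ν : ℝ}

/-- The vector `v` is annihilated by `a - d + q^{1/2}(s + t) b` and `q s t b + c`. -/
structure IsWeight (s t : ℂ) (v : K φ μ ν) : Prop where
  act_c : act (c φ) v = -(q φ * s * t) • act (b φ) v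
  act_d : act (d φ) v = act (a φ) v + (qHalf φ * (s + t)) • act (b φ) v

/-- The element `a + q^{1/2} s b`. -/
def shift (φ : ℝ) (s : ℂ) : SLq φ := a φ + (qHalf φ * s) • b φ

theorem act_shift (s : ℂ) (v : K φ μ ν) :
    act (shift φ s) v = act (a φ) v + (qHalf φ * s) • act (b φ) v := by
  rw [shift, act_add, act_smul]

theorem act_b_a (v : K φ μ ν) :
    act (a φ) (act (b φ) v) = (q φ)⁻¹ • act (b φ) (act (a φ) v) := by
  rw [← act_mul, ← act_mul, a_mul_b, act_smul, smul_smul, inv_mul_cancel₀ (q_ne_zero φ), one_smul]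

theorem act_a_c (v : K φ μ ν) :
    act (c φ) (act (a φ) v) = q φ • act (a φ) (act (c φ) v) := by
  rw [← act_mul, ← act_mul, a_mul_c, act_smul]

theorem act_b_c (v : K φ μ ν) :
    act (c φ) (act (b φ) v) = act (b φ) (act (c φ) v) := by
  rw [← act_mul, ← act_mul, b_mul_c]

theorem act_b_d (v : K φ μ ν) :
    act (d φ) (act (b φ) v) = q φ • act (b φ) (act (d φ) v) := by
  rw [← act_mul, ← act_mul, b_mul_d, act_smul]

theorem act_a_d (v : K φ μ ν) :
    act (d φ) (act (a φ) v) = v + q φ • act (b φ) (act (c φ) v) := by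
  rw [← act_mul, ← act_mul, a_mul_d, act_add, act_one, act_smul, b_mul_c]

theorem act_d_a (v : K φ μ ν) :
    act (a φ) (act (d φ) v) = v + (q φ)⁻¹ • act (b φ) (act (c φ) v) := by
  rw [← act_mul, ← act_mul, d_mul_a, act_add, act_one, act_smul, b_mul_c]

namespace IsWeight

variable {s t : ℂ} {v : K φ μ ν}

theorem symm (h : IsWeight s t v) : IsWeight t s v :=
  ⟨by rw [h.act_c, mul_right_comm], by rw [h.act_d, add_comm s]⟩

/-- Replacing `d` and `c` by their values on `v` in the relation `d a = 1 + q⁻¹ b c` leaves a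
quadratic relation between `a` and `b`. With it, any word of length two applied to a weight vector
is put in normal form, so the shift identities become comparisons of coefficients. -/
theorem act_a_a (h : IsWeight s t v) : act (a φ) (act (a φ) v) =
    v - (s * t) • act (b φ) (act (b φ) v) -
      ((qHalf φ)⁻¹ * (s + t)) • act (b φ) (act (a φ) v) := by
  have hq := q_ne_zero φ
  have hp := qHalf_ne_zero φ
  have h2 := act_d_a v
  rw [h.act_d, h.act_c, map_add, map_smul, map_smul, act_b_a] at h2
  rw [← eq_sub_iff_add_eq] at h2
  rw [h2, ← qHalf_mul_self]
  rw [← qHalf_mul_self] at hq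
  match_scalars <;> field_simp

theorem shift_left (h : IsWeight s t v) :
    IsWeight (q φ * s) ((q φ)⁻¹ * t) (act (shift φ s) v) := by
  have hq := q_ne_zero φ
  have hp := qHalf_ne_zero φ
  have hqp := (qHalf_mul_self φ).symm
  constructor
  · simp only [act_shift, map_add, map_smul, act_a_c, act_b_c, h.act_c, act_b_a]
    rw [hqp] at hq ⊢
    match_scalars <;> field_simp
  · simp only [act_shift, map_add, map_smul, act_a_d, act_b_d, h.act_c, h.act_d, act_b_a,
      h.act_a_a]
    rw [hqp] at hq ⊢
    match_scalars <;> field_simp <;> ring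

theorem shift_right (h : IsWeight s t v) :
    IsWeight ((q φ)⁻¹ * s) (q φ * t) (act (shift φ t) v) :=
  h.symm.shift_left.symm

theorem shift_shift (h : IsWeight s t v) :
    act (shift φ ((q φ)⁻¹ * t)) (act (shift φ s) v) = v := by
  have hq := q_ne_zero φ
  have hp := qHalf_ne_zero φ
  have hqp := (qHalf_mul_self φ).symm
  simp only [act_shift, map_add, map_smul, act_b_a, h.act_a_a]
  rw [hqp] at hq ⊢
  match_scalars <;> field_simp <;> ring

/-- τ sends `a + q^{1/2} w b` to `d - q^{1/2} w̄ b`, and on `v` the element `d` acts as `a + q^{1/2}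
(s + t) b`. Hence `w = s` is preserved when `t = s̄` and exchanged with `t` when `s` is real, which
is the source of the two real forms. -/
theorem τ_shift (h : IsWeight s t v) (w : ℂ) :
    act (τ φ (shift φ w)) v = act (shift φ (s + t - conj w)) v := by
  rw [shift, map_add, LinearMap.map_smulₛₗ, τ_a, τ_b, smul_smul, act_add, act_smul, h.act_d,
    map_mul, show conj (qHalf φ) * conj w * -q φ = -((conj (qHalf φ) * q φ) * conj w) by ring,
    conj_qHalf_mul, act_shift]
  module

/-- Once `c` and `d` are eliminated, the coefficient of `b v ⊗ b v` is `-q s t + q s (s + t) = q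
s²`, exactly what completes the tensor square of `a v + q^{1/2} s b v`. -/
theorem isGroupLikeElem_shift (h : IsWeight s t v) (hv : IsGroupLikeElem ℂ v) :
    IsGroupLikeElem ℂ (act (shift φ s) v) := by
  have hqp := (qHalf_mul_self φ).symm
  constructor
  · rw [counit_act, hv.counit_eq_one, shift, map_add, map_smul, counit_a, counit_b]
    simp
  · rw [comul_act, hv.comul_eq_tmul_self, shift, map_add, map_smul, comul_a, comul_b]
    simp only [map_add, map_smul, LinearMap.add_apply, LinearMap.smul_apply, actTensor_tmul,
      h.act_c, h.act_d, TensorProduct.tmul_add, TensorProduct.add_tmul,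
      TensorProduct.tmul_smul, ← TensorProduct.smul_tmul']
    rw [hqp]
    match_scalars <;> ring

end IsWeight

theorem isWeight_r_one {s t : ℂ} (h₁ : s + t = 2 * μ) (h₂ : s * t = ν) :
    IsWeight s t (r φ μ ν 1) := by
  have e₁ : r φ μ ν (coidealGen₁ φ μ) = 0 := mkQ_gen₁
  have e₂ : r φ μ ν (coidealGen₂ φ ν) = 0 := mkQ_gen₂
  rw [coidealGen₁, map_add, map_sub, map_smul] at e₁
  rw [coidealGen₂, map_add, map_smul] at e₂
  constructor
  · rw [act_r, act_r, one_mul, one_mul, mul_assoc, h₂, eq_comm, neg_smul, neg_eq_iff_add_eq_zero,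
      e₂]
  · rw [act_r, act_r, act_r, one_mul, one_mul, one_mul, h₁, eq_comm, ← sub_eq_zero, ← e₁]
    module

theorem isGroupLikeElem_r_one : IsGroupLikeElem ℂ (r φ μ ν 1) := by
  constructor
  · rw [counit_r, Bialgebra.counit_one]
  · rw [comul_r, Bialgebra.comul_one, Algebra.TensorProduct.one_def, TensorProduct.map_tmul]

theorem τK_r_one : τK φ μ ν (r φ μ ν 1) = r φ μ ν 1 := by
  rw [τK_r, τ_apply, antipode_eq, S_one, star_one]

end Weight

/-! ### Module maps between members of the family, and part (ii) -/

section Translation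

variable {φ μ ν μ' ν' : ℝ} {s t : ℂ}

theorem IsWeight.act_gen₁ {v : K φ μ ν} (h : IsWeight s t v) (h₁ : s + t = 2 * μ') :
    act (coidealGen₁ φ μ') v = 0 := by
  rw [coidealGen₁, map_add, map_sub, map_smul, LinearMap.add_apply, LinearMap.sub_apply,
    LinearMap.smul_apply, h.act_d, h₁]
  module

theorem IsWeight.act_gen₂ {v : K φ μ ν} (h : IsWeight s t v) (h₂ : s * t = ν') :
    act (coidealGen₂ φ ν') v = 0 := by
  rw [coidealGen₂, act_add, act_smul, h.act_c, mul_assoc, h₂]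
  module

/-- The linear map `K_{μ'ν'} → K_{μν}` of right modules that sends the class of `1` to a given
vector of the appropriate weight. -/
def translate (h₁ : s + t = 2 * μ') (h₂ : s * t = ν') (v : K φ μ ν) (h : IsWeight s t v) :
    K φ μ' ν' →ₗ[ℂ] K φ μ ν :=
  (Rℂ φ μ' ν').liftQ (LinearMap.flip act v) fun x hx => by
    refine R_induction (P := fun x => x ∈ LinearMap.ker (LinearMap.flip act v))
      (zero_mem _) (fun _ _ => add_mem) (fun y => ?_) (fun y => ?_) hx
    · rw [LinearMap.mem_ker, LinearMap.flip_apply, act_mul, h.act_gen₁ h₁, map_zero]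
    · rw [LinearMap.mem_ker, LinearMap.flip_apply, act_mul, h.act_gen₂ h₂, map_zero]

variable {h₁ : s + t = 2 * μ'} {h₂ : s * t = ν'} {v : K φ μ ν} {h : IsWeight s t v}

theorem translate_r (x : SLq φ) : translate h₁ h₂ v h (r φ μ' ν' x) = act x v := rfl

theorem translate_act (y : SLq φ) (k : K φ μ' ν') :
    translate h₁ h₂ v h (act y k) = act y (translate h₁ h₂ v h k) := by
  obtain ⟨x, rfl⟩ := r_surjective φ μ' ν' k
  rw [act_r, translate_r, translate_r, act_mul]

theorem translate_τK (hτ : τK φ μ ν v = v) (k : K φ μ' ν') :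
    translate h₁ h₂ v h (τK φ μ' ν' k) = τK φ μ ν (translate h₁ h₂ v h k) := by
  obtain ⟨x, rfl⟩ := r_surjective φ μ' ν' k
  rw [τK_r, translate_r, translate_r, τK_act, hτ]

theorem counit_translate (hv : IsGroupLikeElem ℂ v) (k : K φ μ' ν') :
    Coalgebra.counit (R := ℂ) (translate h₁ h₂ v h k) = Coalgebra.counit (R := ℂ) k := by
  obtain ⟨x, rfl⟩ := r_surjective φ μ' ν' k
  rw [translate_r, counit_act, hv.counit_eq_one, one_mul, counit_r]

theorem comul_translate (hv : IsGroupLikeElem ℂ v) (k : K φ μ' ν') :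
    TensorProduct.map (translate h₁ h₂ v h) (translate h₁ h₂ v h) (Coalgebra.comul k) =
      Coalgebra.comul (R := ℂ) (translate h₁ h₂ v h k) := by
  obtain ⟨x, rfl⟩ := r_surjective φ μ' ν' k
  rw [translate_r, comul_act, hv.comul_eq_tmul_self, comul_r]
  generalize Coalgebra.comul (R := ℂ) x = u
  induction u with
  | zero => simp
  | add u w hu hw => simp only [map_add, LinearMap.add_apply, hu, hw]
  | tmul x y => simp [translate_r]

/-- Isomorphism of real coalgebras and right modules between two members of the family. -/
def ModuleCoalgIso (φ ν μ μ' : ℝ) : Prop :=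
  ∃ e : K φ μ ν ≃ₗc[ℂ] K φ μ' ν,
    (∀ (x : SLq φ) (k : K φ μ ν), e (MulOpposite.op x • k) = MulOpposite.op x • e k) ∧
    ∀ k : K φ μ ν, e (τK φ μ ν k) = τK φ μ' ν (e k)

namespace ModuleCoalgIso

theorem refl (φ ν μ : ℝ) : ModuleCoalgIso φ ν μ μ :=
  ⟨CoalgEquiv.refl ℂ _, fun _ _ => rfl, fun _ => rfl⟩

theorem symm {μ μ' : ℝ} (H : ModuleCoalgIso φ ν μ μ') : ModuleCoalgIso φ ν μ' μ := by
  obtain ⟨e, he, hτ⟩ := H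
  refine ⟨e.symm, fun x k => ?_, fun k => ?_⟩
  · apply EquivLike.injective e
    rw [he, e.apply_symm_apply, e.apply_symm_apply]
  · apply EquivLike.injective e
    rw [hτ, e.apply_symm_apply, e.apply_symm_apply]

theorem trans {μ μ' μ'' : ℝ} (H : ModuleCoalgIso φ ν μ μ') (H' : ModuleCoalgIso φ ν μ' μ'') :
    ModuleCoalgIso φ ν μ μ'' := by
  obtain ⟨e, he, hτ⟩ := H
  obtain ⟨e', he', hτ'⟩ := H'
  refine ⟨e.trans e', fun x k => ?_, fun k => ?_⟩
  · rw [CoalgEquiv.trans_apply, CoalgEquiv.trans_apply, he, he']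
  · rw [CoalgEquiv.trans_apply, CoalgEquiv.trans_apply, hτ, hτ']

end ModuleCoalgIso

/-- Shifting the parameters `(s, s̄)` to `(q s, q̄ s̄)` gives isomorphic real coalgebras and
right modules. -/
theorem moduleCoalgIso_shift (φ : ℝ) {μ μ' ν : ℝ} {s : ℂ} (h₁ : s + conj s = 2 * μ)
    (h₂ : s * conj s = ν) (h₁' : q φ * s + (q φ)⁻¹ * conj s = 2 * μ') :
    ModuleCoalgIso φ ν μ' μ := by
  have hq := q_ne_zero φ
  have h₂' : q φ * s * ((q φ)⁻¹ * conj s) = ν := by rw [← h₂]; field_simp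
  have w : IsWeight s (conj s) (r φ μ ν 1) := isWeight_r_one h₁ h₂
  have w' : IsWeight (q φ * s) ((q φ)⁻¹ * conj s) (r φ μ' ν 1) := isWeight_r_one h₁' h₂'
  -- The reverse shift of the class of `1` in the other quotient; it defines the inverse map.
  have u : IsWeight s (conj s) (act (shift φ ((q φ)⁻¹ * conj s)) (r φ μ' ν 1)) := by
    simpa [hq] using w'.shift_right
  have hv := w.isGroupLikeElem_shift isGroupLikeElem_r_one
  have hτ : τK φ μ ν (act (shift φ s) (r φ μ ν 1)) = act (shift φ s) (r φ μ ν 1) := by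
    rw [τK_act, τK_r_one, w.τ_shift, add_sub_cancel_right]
  let f := translate h₁' h₂' _ w.shift_left
  let g := translate h₁ h₂ _ u
  -- Both composites are right module maps, so it suffices that they fix the cyclic vector, which is
  -- `shift_shift`.
  have hfg (k) : f (g k) = k := by
    obtain ⟨x, rfl⟩ := r_surjective φ μ ν k
    rw [translate_r, translate_act, translate_act, r_eq_act x]
    congr 1
    rw [translate_r, act_one, w.shift_shift]
  have hgf (k) : g (f k) = k := by
    obtain ⟨x, rfl⟩ := r_surjective φ μ' ν k
    rw [translate_r, translate_act, translate_act, r_eq_act x]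
    congr 1
    rw [translate_r, act_one]
    simpa [hq] using w'.symm.shift_shift
  let F : K φ μ' ν →ₗc[ℂ] K φ μ ν :=
    { f with
      counit_comp := LinearMap.ext fun k => counit_translate hv k
      map_comp_comul := LinearMap.ext fun k => comul_translate hv k }
  have hF : Function.Bijective F := Function.bijective_iff_has_inverse.2 ⟨g, hgf, hfg⟩
  exact ⟨CoalgEquiv.ofBijective hF, fun x k => translate_act (h₁ := h₁') (h₂ := h₂') (h := w.shift_left) x k,
    fun k => translate_τK (h₁ := h₁') (h₂ := h₂') (h := w.shift_left) hτ k⟩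

theorem exp_parameter_add_conj (ρ θ : ℝ) :
    (ρ * Complex.exp (θ * Complex.I)) + conj (ρ * Complex.exp (θ * Complex.I)) =
      2 * (ρ * Real.cos θ : ℝ) := by
  rw [Complex.add_conj, Complex.re_ofReal_mul, Complex.exp_ofReal_mul_I_re]
  push_cast; ring

theorem exp_parameter_mul_conj {ν : ℝ} (hν : 0 ≤ ν) (θ : ℝ) :
    (√ν * Complex.exp (θ * Complex.I)) * conj (√ν * Complex.exp (θ * Complex.I)) = ν := by
  rw [Complex.mul_conj, map_mul, Complex.normSq_ofReal, Real.mul_self_sqrt hν,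
    Complex.normSq_eq_norm_sq, Complex.norm_exp_ofReal_mul_I]
  simp

theorem moduleCoalgIso_cos_add (φ : ℝ) {ν : ℝ} (hν : 0 ≤ ν) (θ : ℝ) :
    ModuleCoalgIso φ ν (√ν * Real.cos θ) (√ν * Real.cos (θ + φ)) := by
  refine (moduleCoalgIso_shift φ (exp_parameter_add_conj √ν θ) (exp_parameter_mul_conj hν θ)
    ?_).symm
  rw [← exp_parameter_add_conj, ← conj_q, ← map_mul]
  have : q φ * (√ν * Complex.exp (θ * Complex.I)) =
      √ν * Complex.exp ((θ + φ : ℝ) * Complex.I) := by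
    rw [q, mul_left_comm, ← Complex.exp_add]
    push_cast; ring_nf
  rw [this]

theorem moduleCoalgIso_cos_add_int_mul (φ : ℝ) {ν : ℝ} (hν : 0 ≤ ν) (θ : ℝ) (n : ℤ) :
    ModuleCoalgIso φ ν (√ν * Real.cos θ) (√ν * Real.cos (θ + n * φ)) := by
  induction n with
  | zero => simpa using ModuleCoalgIso.refl φ ν (√ν * Real.cos θ)
  | succ n ih =>
    have := ih.trans (moduleCoalgIso_cos_add φ hν _)
    rwa [show θ + (n : ℤ) * φ + φ = θ + ((n + 1 : ℤ) : ℝ) * φ by push_cast; ring] at this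
  | pred n ih =>
    have := moduleCoalgIso_cos_add φ hν (θ + ((-n - 1 : ℤ) : ℝ) * φ)
    rw [show θ + ((-n - 1 : ℤ) : ℝ) * φ + φ = θ + ((-n : ℤ) : ℝ) * φ by push_cast; ring] at this
    exact ih.trans this.symm

end Translation

/-! ### Composition and inversion of real coalgebra isomorphisms -/

section RealCoalgIso

variable {A B D : Type*} [AddCommGroup A] [Module ℂ A] [Coalgebra ℂ A] [AddCommGroup B]
  [Module ℂ B] [Coalgebra ℂ B] [AddCommGroup D] [Module ℂ D] [Coalgebra ℂ D]
  {σ : A → A} {ρ : B → B} {π : D → D}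

theorem RealCoalgIso.symm (H : RealCoalgIso σ ρ) : RealCoalgIso ρ σ := by
  obtain ⟨e, he⟩ := H
  refine ⟨e.symm, fun x => EquivLike.injective e ?_⟩
  rw [he, e.apply_symm_apply, e.apply_symm_apply]

theorem RealCoalgIso.trans (H : RealCoalgIso σ ρ) (H' : RealCoalgIso ρ π) :
    RealCoalgIso σ π := by
  obtain ⟨e, he⟩ := H
  obtain ⟨e', he'⟩ := H'
  refine ⟨e.trans e', fun x => ?_⟩
  rw [CoalgEquiv.trans_apply, CoalgEquiv.trans_apply, he, he']

theorem ModuleCoalgIso.realCoalgIso {φ ν μ μ' : ℝ} (H : ModuleCoalgIso φ ν μ μ') :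
    RealCoalgIso (τK φ μ ν) (τK φ μ' ν) :=
  let ⟨e, _, he⟩ := H
  ⟨e, he⟩

end RealCoalgIso

/-! ### Rescaling automorphisms and the special series -/

section Scaling

variable {φ μ ν : ℝ} {t : ℝ}

theorem scale_quad (φ : ℝ) (ht : t ≠ 0) :
    Quad φ (a φ) ((t : ℂ) • b φ) ((t : ℂ)⁻¹ • c φ) (d φ) := by
  have ht' : (t : ℂ) ≠ 0 := by exact_mod_cast ht
  constructor <;>
  simp only [smul_mul_assoc, mul_smul_comm, a_mul_b, a_mul_c, b_mul_d, c_mul_d, d_mul_a, a_mul_d,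
    b_mul_c] <;>
  match_scalars <;> field_simp

/-- The Hopf `*`-automorphism `b ↦ t b`, `c ↦ t⁻¹ c` of `SL_q(2,ℝ)`. -/
def scale (φ : ℝ) (ht : t ≠ 0) : SLq φ →ₐ[ℂ] SLq φ := lift (scale_quad φ ht)

theorem scale_scale_inv (ht : t ≠ 0) (x : SLq φ) :
    scale φ ht (scale φ (inv_ne_zero ht) x) = x := by
  have ht' : (t : ℂ) ≠ 0 := by exact_mod_cast ht
  have : (scale φ ht).comp (scale φ (inv_ne_zero ht)) = AlgHom.id ℂ _ := by
    apply algHom_ext <;> simp [scale, smul_smul, ht', -Complex.coe_smul]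
  exact DFunLike.congr_fun this x

theorem scale_inv_scale (ht : t ≠ 0) (x : SLq φ) :
    scale φ (inv_ne_zero ht) (scale φ ht x) = x := by
  have ht' : (t : ℂ) ≠ 0 := by exact_mod_cast ht
  have : (scale φ (inv_ne_zero ht)).comp (scale φ ht) = AlgHom.id ℂ _ := by
    apply algHom_ext <;> simp [scale, smul_smul, ht', -Complex.coe_smul]
  exact DFunLike.congr_fun this x

theorem comul_scale (ht : t ≠ 0) (x : SLq φ) :
    Coalgebra.comul (R := ℂ) (scale φ ht x) =
      TensorProduct.map (scale φ ht).toLinearMap (scale φ ht).toLinearMap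
        (Coalgebra.comul (R := ℂ) x) := by
  have ht' : (t : ℂ) ≠ 0 := by exact_mod_cast ht
  have : (Bialgebra.comulAlgHom ℂ (SLq φ)).comp (scale φ ht) =
      (Algebra.TensorProduct.map (scale φ ht) (scale φ ht)).comp
        (Bialgebra.comulAlgHom ℂ (SLq φ)) := by
    apply algHom_ext <;>
    simp [scale, comul_a, comul_b, comul_c, comul_d, TensorProduct.tmul_smul,
      ← TensorProduct.smul_tmul', smul_smul, ht', -Complex.coe_smul]
  exact DFunLike.congr_fun this x

theorem counit_scale (ht : t ≠ 0) (x : SLq φ) :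
    Coalgebra.counit (R := ℂ) (scale φ ht x) = Coalgebra.counit (R := ℂ) x := by
  have : (Bialgebra.counitAlgHom ℂ (SLq φ)).comp (scale φ ht) =
      Bialgebra.counitAlgHom ℂ (SLq φ) := by
    apply algHom_ext <;> simp [scale, counit_a, counit_b, counit_c, counit_d]
  exact DFunLike.congr_fun this x

/-- Both sides are antilinear and multiplicative, so the generators decide; there the reality of `t`
lets the scalar pass through τ. -/
theorem scale_τ (ht : t ≠ 0) (x : SLq φ) : scale φ ht (τ φ x) = τ φ (scale φ ht x) := by
  induction x using induction with
  | halg z =>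
    simp only [Algebra.algebraMap_eq_smul_one, LinearMap.map_smulₛₗ, map_smul, map_one]
    rw [τ_apply, antipode_eq, S_one, star_one, map_one]
  | ha => simp [scale, τ_a]
  | hb => simp [scale, τ_b, smul_smul, mul_comm, -Complex.coe_smul]
  | hc => simp [scale, τ_c, smul_smul, mul_comm, -Complex.coe_smul]
  | hd => simp [scale, τ_d]
  | hadd x y hx hy => simp only [map_add, hx, hy]
  | hmul x y hx hy => simp only [map_mul, τ_mul, hx, hy]

theorem scale_mem_R (ht : t ≠ 0) {μ' ν' : ℝ} (hμ : μ' = t * μ) (hν : ν' = t ^ 2 * ν)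
    {x : SLq φ} (hx : x ∈ R φ μ ν) : scale φ ht x ∈ R φ μ' ν' := by
  have ht' : (t : ℂ) ≠ 0 := by exact_mod_cast ht
  refine R_induction (P := fun x => scale φ ht x ∈ R φ μ' ν') ?_ ?_ (fun y => ?_) (fun y => ?_) hx
  · simp
  · intro x y hx hy; rw [map_add]; exact add_mem hx hy
  · rw [map_mul]
    refine mem_R_mul ?_ _
    have : scale φ ht (coidealGen₁ φ μ) = coidealGen₁ φ μ' := by
      simp only [scale, coidealGen₁, map_add, map_sub, map_smul, lift_a, lift_b, lift_d, hμ]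
      push_cast
      module
    rw [this]; exact gen₁_mem
  · rw [map_mul]
    refine mem_R_mul ?_ _
    have : scale φ ht (coidealGen₂ φ ν) = (t : ℂ)⁻¹ • coidealGen₂ φ ν' := by
      simp only [scale, coidealGen₂, map_add, map_smul, lift_b, lift_c, hν]
      push_cast
      match_scalars <;> field_simp
    rw [this]; exact (Rℂ φ μ' ν').smul_mem _ gen₂_mem

/-- The parameters `(μ, ν)` and `(t μ, t² ν)` give isomorphic real coalgebras. -/
theorem realCoalgIso_scale (φ : ℝ) (ht : t ≠ 0) {μ ν μ' ν' : ℝ} (hμ : μ' = t * μ)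
    (hν : ν' = t ^ 2 * ν) : RealCoalgIso (τK φ μ ν) (τK φ μ' ν') := by
  let f : K φ μ ν →ₗ[ℂ] K φ μ' ν' := (Rℂ φ μ ν).mapQ (Rℂ φ μ' ν') (scale φ ht).toLinearMap
    fun _ hx => scale_mem_R ht hμ hν hx
  let g : K φ μ' ν' →ₗ[ℂ] K φ μ ν :=
    (Rℂ φ μ' ν').mapQ (Rℂ φ μ ν) (scale φ (inv_ne_zero ht)).toLinearMap
      fun _ hx => scale_mem_R (inv_ne_zero ht) (by rw [hμ]; field_simp) (by rw [hν]; field_simp) hx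
  have hf (x) : f (r φ μ ν x) = r φ μ' ν' (scale φ ht x) := rfl
  have hg (x) : g (r φ μ' ν' x) = r φ μ ν (scale φ (inv_ne_zero ht) x) := rfl
  have hfg (k) : f (g k) = k := by
    obtain ⟨x, rfl⟩ := r_surjective φ μ' ν' k
    rw [hg, hf, scale_scale_inv]
  have hgf (k) : g (f k) = k := by
    obtain ⟨x, rfl⟩ := r_surjective φ μ ν k
    rw [hf, hg, scale_inv_scale]
  have hε (k) : Coalgebra.counit (R := ℂ) (f k) = Coalgebra.counit (R := ℂ) k := by
    obtain ⟨x, rfl⟩ := r_surjective φ μ ν k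
    rw [hf, counit_r, counit_scale, counit_r]
  have hΔ (k) : TensorProduct.map f f (Coalgebra.comul k) = Coalgebra.comul (R := ℂ) (f k) := by
    obtain ⟨x, rfl⟩ := r_surjective φ μ ν k
    rw [hf, comul_r, comul_r, comul_scale]
    generalize Coalgebra.comul (R := ℂ) x = u
    induction u with
    | zero => simp
    | add u w hu hw => simp only [map_add, hu, hw]
    | tmul x y => simp [hf]
  let F : K φ μ ν →ₗc[ℂ] K φ μ' ν' :=
    { f with
      counit_comp := LinearMap.ext hε
      map_comp_comul := LinearMap.ext hΔ }
  have hF : Function.Bijective F := Function.bijective_iff_has_inverse.2 ⟨g, hgf, hfg⟩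
  refine ⟨CoalgEquiv.ofBijective hF, fun k => ?_⟩
  obtain ⟨x, rfl⟩ := r_surjective φ μ ν k
  change f (τK φ μ ν _) = τK φ μ' ν' (f _)
  rw [hf, τK_r, τK_r, hf, scale_τ]

/-- The members of the special series are isomorphic to `K_{11}`. -/
theorem realCoalgIso_special {φ θ : ℝ} (l : ℤ) (hν : 0 < ν) (hμ : μ / √ν = Real.cos θ)
    (hθ : Real.cos θ ^ 2 = Real.cos (l * φ) ^ 2) : RealCoalgIso (τK φ μ ν) (τK φ 1 1) := by
  have hs : √ν ≠ 0 := (Real.sqrt_pos.2 hν).ne'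
  rw [div_eq_iff hs, mul_comm] at hμ
  subst hμ
  rcases sq_eq_sq_iff_eq_or_eq_neg.1 hθ with h | h
  -- Moving the angle from `lφ` back to `0` gives `μ = √ν`, and scaling by `1/√ν` then gives `(1,
  -- 1)`.
  · have H := (moduleCoalgIso_cos_add_int_mul φ hν.le 0 l).symm.realCoalgIso
    rw [zero_add, ← h] at H
    refine H.trans (realCoalgIso_scale φ (inv_ne_zero hs) ?_ ?_)
    · simp [hs]
    · rw [inv_pow, Real.sq_sqrt hν.le, inv_mul_cancel₀ hν.ne']
  -- The opposite sign is reached from the angle `π`, where `μ = -√ν`; a negative scaling factor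
  -- corrects the sign, since `ν` sees only its square.
  · have H := (moduleCoalgIso_cos_add_int_mul φ hν.le Real.pi l).symm.realCoalgIso
    rw [add_comm, Real.cos_add_pi, ← h] at H
    refine H.trans (realCoalgIso_scale φ (neg_ne_zero.2 (inv_ne_zero hs)) ?_ ?_)
    · simp [hs]
    · rw [neg_sq, inv_pow, Real.sq_sqrt hν.le, inv_mul_cancel₀ hν.ne']

end Scaling

/-! ### The two-sided ladder of group-like vectors -/

section Ladder

variable {φ μ ν : ℝ} {s t : ℂ}

/-- The vectors obtained from `v` by repeatedly raising the weight. -/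
def raise (s : ℂ) (v : K φ μ ν) : ℕ → K φ μ ν
  | 0 => v
  | n + 1 => act (shift φ (q φ ^ (n : ℤ) * s)) (raise s v n)

theorem IsWeight.raise {v : K φ μ ν} (h : IsWeight s t v) (n : ℕ) :
    IsWeight (q φ ^ (n : ℤ) * s) (q φ ^ (-n : ℤ) * t) (raise s v n) := by
  induction n with
  | zero => simpa [QuantumSL2.raise] using h
  | succ n ih =>
    have := ih.shift_left
    rwa [← mul_assoc, ← mul_assoc, ← zpow_one_add₀ (q_ne_zero φ), ← zpow_neg_one,
      ← zpow_add₀ (q_ne_zero φ), ← neg_add, add_comm 1] at this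

/-- A family of vectors of weights `(qⁿ s, q⁻ⁿ t)` linked by the shifts. -/
structure IsLadder (s t : ℂ) (g : ℤ → K φ μ ν) : Prop where
  weight (n : ℤ) : IsWeight (q φ ^ n * s) (q φ ^ (-n) * t) (g n)
  up (n : ℤ) : act (shift φ (q φ ^ n * s)) (g n) = g (n + 1)
  down (n : ℤ) : act (shift φ (q φ ^ (-n) * t)) (g n) = g (n - 1)

theorem IsWeight.exists_ladder {v : K φ μ ν} (h : IsWeight s t v) :
    ∃ g : ℤ → K φ μ ν, g 0 = v ∧ IsLadder s t g := by
  have key {s t : ℂ} (h : IsWeight s t v) (n : ℕ) :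
      act (shift φ (q φ ^ (-(n + 1) : ℤ) * t)) (QuantumSL2.raise s v (n + 1)) =
        QuantumSL2.raise s v n := by
    have := (h.raise n).shift_shift
    rwa [← mul_assoc, ← zpow_neg_one, ← zpow_add₀ (q_ne_zero φ), ← neg_add, add_comm 1] at this
  -- Lowering is raising with `s` and `t` exchanged. As `Int.negSucc n` is `-(n + 1)`, it needs `n +
  -- 1` steps.
  refine ⟨fun n => match n with
    | Int.ofNat n => QuantumSL2.raise s v n
    | Int.negSucc n => QuantumSL2.raise t v (n + 1), rfl, ?_, ?_, ?_⟩
  · rintro (n | n)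
    · exact h.raise n
    · simpa [Int.negSucc_eq] using (h.symm.raise (n + 1)).symm
  · rintro (n | n)
    · rfl
    · rcases n with _ | n
      · exact key h.symm 0
      · exact key h.symm (n + 1)
  · rintro (n | n)
    · rcases n with _ | n
      · rfl
      · simpa using key h n
    · rfl

namespace IsLadder

variable {g : ℤ → K φ μ ν}

theorem isGroupLikeElem (h : IsLadder s t g) (h0 : IsGroupLikeElem ℂ (g 0)) (n : ℤ) :
    IsGroupLikeElem ℂ (g n) := by
  induction n with
  | zero => exact h0
  | succ n ih =>
    rw [← h.up]
    exact (h.weight _).isGroupLikeElem_shift ih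
  | pred n ih =>
    rw [← h.down]
    exact (h.weight _).symm.isGroupLikeElem_shift ih

theorem τK_of_conj_eq (h : IsLadder s (conj s) g) (h0 : τK φ μ ν (g 0) = g 0) (n : ℤ) :
    τK φ μ ν (g n) = g n := by
  induction n with
  | zero => exact h0
  | succ n ih =>
    rw [← h.up, τK_act, ih, (h.weight _).τ_shift]
    simp only [map_mul, conj_q_zpow, add_sub_cancel_right]
  | pred n ih =>
    rw [← h.down, τK_act, ih, (h.weight _).τ_shift]
    simp only [map_mul, conj_q_zpow, neg_neg, Complex.conj_conj, add_sub_cancel_left]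

/-- Conjugation inverts `q` but fixes `s` and `t`, so τ turns the upward shift at `n` into the
downward shift at `-n`. -/
theorem τK_of_real (h : IsLadder s t g) (hs : conj s = s) (ht : conj t = t)
    (h0 : τK φ μ ν (g 0) = g 0) (n : ℤ) : τK φ μ ν (g n) = g (-n) := by
  induction n with
  | zero => exact h0
  | succ n ih =>
    rw [← h.up, τK_act, ih, (h.weight _).τ_shift, neg_add', ← h.down]
    simp only [map_mul, conj_q_zpow, hs, add_sub_cancel_left]
  | pred n ih =>
    rw [← h.down, τK_act, ih, (h.weight _).τ_shift, neg_sub', sub_neg_eq_add, ← h.up]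
    simp only [map_mul, conj_q_zpow, ht, neg_neg, add_sub_cancel_right]

/-- The span contains the cyclic vector, so stability under the generators is enough; `c` and `d`
reduce to `a` and `b` on weight vectors. -/
theorem span_eq_top (h : IsLadder s t g) (h0 : g 0 = r φ μ ν 1)
    (hst : ∀ n : ℤ, q φ ^ n * s ≠ q φ ^ (-n) * t) :
    Submodule.span ℂ (Set.range g) = ⊤ := by
  set M := Submodule.span ℂ (Set.range g) with hM
  have hg (n : ℤ) : g n ∈ M := Submodule.subset_span ⟨n, rfl⟩
  have hb (n : ℤ) : act (b φ) (g n) ∈ M := by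
    have hne : qHalf φ * (q φ ^ n * s - q φ ^ (-n) * t) ≠ 0 :=
      mul_ne_zero (qHalf_ne_zero φ) (sub_ne_zero.2 (hst n))
    rw [← M.smul_mem_iff hne]
    -- Subtracting the two shifts of `g n` cancels `a` and leaves `q^{1/2} (qⁿ s - q⁻ⁿ t) b`, whose
    -- coefficient is nonzero.
    have := sub_mem (hg (n + 1)) (hg (n - 1))
    rw [← h.up, ← h.down, act_shift, act_shift] at this
    convert this using 1
    module
  have ha (n : ℤ) : act (a φ) (g n) ∈ M := by
    have := sub_mem (hg (n + 1)) (M.smul_mem (qHalf φ * (q φ ^ n * s)) (hb n))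
    rwa [← h.up, act_shift, add_sub_cancel_right] at this
  have extend {y : SLq φ} (hy : ∀ n, act y (g n) ∈ M) : ∀ v ∈ M, act y v ∈ M := by
    intro v hv
    have : M ≤ M.comap (act y) := by
      rw [hM, Submodule.span_le, ← hM]
      rintro _ ⟨n, rfl⟩
      exact hy n
    exact this hv
  have key (x : SLq φ) : ∀ v ∈ M, act x v ∈ M := by
    induction x using induction with
    | halg z =>
      intro v hv
      rw [Algebra.algebraMap_eq_smul_one, act_smul, act_one]
      exact M.smul_mem _ hv
    | ha => exact extend ha
    | hb => exact extend hb
    | hc => exact extend fun n => by rw [(h.weight n).act_c]; exact M.smul_mem _ (hb n)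
    | hd =>
      exact extend fun n => by rw [(h.weight n).act_d]; exact add_mem (ha n) (M.smul_mem _ (hb n))
    | hadd x y hx hy => intro v hv; rw [act_add]; exact add_mem (hx v hv) (hy v hv)
    | hmul x y hx hy => intro v hv; rw [act_mul]; exact hy _ (hx v hv)
  rw [eq_top_iff]
  rintro v -
  obtain ⟨x, rfl⟩ := r_surjective φ μ ν v
  rw [r_eq_act, ← h0]
  exact key x _ (hg 0)

end IsLadder

end Ladder

/-! ### A representation on functions on `ℤ` and independence of the ladder -/

section Representation

variable {φ : ℝ} {s t : ℂ}

/-- The operator `f ↦ (n ↦ α n f(n+1) + β n f(n-1))` on functions on `ℤ`. -/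
def jacobi (α β : ℤ → ℂ) : Module.End ℂ (ℤ → ℂ) where
  toFun f n := α n * f (n + 1) + β n * f (n - 1)
  map_add' f g := by ext n; simp only [Pi.add_apply]; ring
  map_smul' z f := by ext n; simp only [Pi.smul_apply, smul_eq_mul, RingHom.id_apply]; ring

theorem jacobi_apply (α β : ℤ → ℂ) (f : ℤ → ℂ) (n : ℤ) :
    jacobi α β f n = α n * f (n + 1) + β n * f (n - 1) := rfl

variable (φ s t) in
/-- The denominator `q²ⁿ s - t` in the representation of `SL_q(2,ℝ)` on functions on `ℤ`. -/
def den (n : ℤ) : ℂ := (q φ ^ n) ^ 2 * s - t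

variable (φ s t) in
/-- The operator by which `a` acts on functions on `ℤ`. -/
def opA : Module.End ℂ (ℤ → ℂ) :=
  jacobi (fun n => -t / den φ s t n) (fun n => (q φ ^ n) ^ 2 * s / den φ s t n)

variable (φ s t) in
/-- The operator by which `b` acts on functions on `ℤ`. -/
def opB : Module.End ℂ (ℤ → ℂ) :=
  jacobi (fun n => q φ ^ n / (qHalf φ * den φ s t n))
    (fun n => -q φ ^ n / (qHalf φ * den φ s t n))

variable (φ s t) in
/-- The operator by which `d` acts on functions on `ℤ`. -/
def opD : Module.End ℂ (ℤ → ℂ) :=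
  jacobi (fun n => (q φ ^ n) ^ 2 * s / den φ s t n) (fun n => -t / den φ s t n)

/-- The operators are the transposes of the action on a ladder: solving the two shift equations for
`a (g n)` and `b (g n)` gives their coefficients. The product `s t` of the weights is constant along
the ladder, hence `c` is a scalar multiple of `b`. -/
theorem op_quad (hden : ∀ n, den φ s t n ≠ 0) :
    Quad φ (opA φ s t) (opB φ s t) (-(q φ * s * t) • opB φ s t) (opD φ s t) := by
  have hq := q_ne_zero φ
  have hp := qHalf_ne_zero φ
  have hqp := (qHalf_mul_self φ).symm
  have main (f : ℤ → ℂ) (n : ℤ) :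
      opA φ s t (opB φ s t f) n = q φ * opB φ s t (opA φ s t f) n ∧
      opB φ s t (opD φ s t f) n = q φ * opD φ s t (opB φ s t f) n ∧
      opD φ s t (opA φ s t f) n = f n - s * t * opB φ s t (opB φ s t f) n ∧
      opA φ s t (opD φ s t f) n = f n - q φ ^ 2 * s * t * opB φ s t (opB φ s t f) n := by
    have h₀ := hden n
    have h₁ := hden (n + 1)
    have h₂ := hden (n - 1)
    have hY : q φ ^ (n - 1) ≠ 0 := zpow_ne_zero _ hq
    have hn : q φ ^ n = q φ ^ (n - 1) * q φ := by
      rw [← zpow_add_one₀ hq, sub_add_cancel]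
    have hn' : q φ ^ (n + 1) = q φ ^ (n - 1) * q φ * q φ := by rw [zpow_add_one₀ hq, hn]
    have e₀ : den φ s t n = (q φ ^ (n - 1) * q φ) ^ 2 * s - t := by rw [den, hn]
    have e₁ : den φ s t (n + 1) = (q φ ^ (n - 1) * q φ * q φ) ^ 2 * s - t := by rw [den, hn']
    have e₂ : den φ s t (n - 1) = (q φ ^ (n - 1)) ^ 2 * s - t := rfl
    simp only [opA, opB, opD, jacobi_apply, add_sub_cancel_right, sub_add_cancel]
    rw [hn, hn']
    -- The denominators stay atoms while fractions are cleared; only then are they expanded as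
    -- polynomials in `q ^ (n - 1)`.
    generalize den φ s t n = E₀ at *
    generalize den φ s t (n + 1) = E₁ at *
    generalize den φ s t (n - 1) = E₂ at *
    generalize q φ ^ (n - 1) = Y at *
    generalize f (n + 1 + 1) = f₂
    generalize f (n - 1 - 1) = f₃
    generalize f n = f₁
    rw [hqp] at *
    generalize qHalf φ = p at *
    refine ⟨?_, ?_, ?_, ?_⟩ <;> field_simp <;> simp only [e₀, e₁, e₂] <;> ring
  constructor
  · ext f n; exact (main f n).1
  · ext f n
    simp only [Module.End.mul_apply, LinearMap.smul_apply, map_smul, Pi.smul_apply, smul_eq_mul,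
      (main f n).1]
    ring
  · rw [mul_smul_comm, smul_mul_assoc]
  · ext f n; exact (main f n).2.1
  · ext f n
    simp only [Module.End.mul_apply, LinearMap.smul_apply, map_smul, Pi.smul_apply, smul_eq_mul,
      (main f n).2.1]
    ring
  · ext f n
    simp only [Module.End.mul_apply, LinearMap.smul_apply, LinearMap.add_apply, map_smul,
      Pi.smul_apply, Pi.add_apply, smul_eq_mul, (main f n).2.2.1, Module.End.one_apply]
    field_simp
    ring
  · ext f n
    simp only [Module.End.mul_apply, LinearMap.smul_apply, LinearMap.add_apply, map_smul,
      Pi.smul_apply, Pi.add_apply, smul_eq_mul, (main f n).2.2.2, Module.End.one_apply]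
    ring

/-- The representation of `SL_q(2,ℝ)` on functions on `ℤ`. -/
def rep (hden : ∀ n, den φ s t n ≠ 0) : SLq φ →ₐ[ℂ] Module.End ℂ (ℤ → ℂ) := lift (op_quad hden)

variable {μ ν : ℝ}

/-- Evaluation of matrix coefficients of the representation at `0` factors through `K_{μν}`. -/
theorem rep_eq_zero_of_mem_R (hden : ∀ n, den φ s t n ≠ 0) (h₁ : s + t = 2 * μ) (h₂ : s * t = ν)
    {x : SLq φ} (hx : x ∈ R φ μ ν) (f : ℤ → ℂ) : rep hden x f 0 = 0 := by
  have hp := qHalf_ne_zero φ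
  have h0 : s - t ≠ 0 := by simpa [den] using hden 0
  refine R_induction (P := fun x => rep hden x f 0 = 0) ?_ ?_ (fun y => ?_) (fun y => ?_) hx
  · simp
  · intro x y hx hy
    rw [map_add, LinearMap.add_apply, Pi.add_apply, hx, hy, add_zero]
  · rw [map_mul, Module.End.mul_apply]
    generalize rep hden y f = g
    simp only [coidealGen₁, map_add, map_sub, map_smul, rep, lift_a, lift_b, lift_d,
      LinearMap.add_apply, LinearMap.sub_apply, LinearMap.smul_apply, Pi.add_apply, Pi.sub_apply,
      Pi.smul_apply, smul_eq_mul, opA, opB, opD, jacobi_apply, den, zpow_zero, one_pow, one_mul]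
    rw [show 2 * qHalf φ * (μ : ℂ) = qHalf φ * (s + t) by rw [h₁]; ring]
    field_simp
    ring
  · rw [map_mul, Module.End.mul_apply]
    generalize rep hden y f = g
    simp only [coidealGen₂, map_add, map_smul, rep, lift_b, lift_c, LinearMap.add_apply,
      LinearMap.smul_apply, Pi.add_apply, Pi.smul_apply, smul_eq_mul, ← h₂]
    ring

/-- The linear functional on `K_{μν}` given by a function on `ℤ`. -/
def functional (hden : ∀ n, den φ s t n ≠ 0) (h₁ : s + t = 2 * μ) (h₂ : s * t = ν)
    (f : ℤ → ℂ) : K φ μ ν →ₗ[ℂ] ℂ :=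
  (Rℂ φ μ ν).liftQ ((LinearMap.proj 0 : (ℤ → ℂ) →ₗ[ℂ] ℂ) ∘ₗ LinearMap.applyₗ f ∘ₗ (rep hden).toLinearMap)
    fun _ hx => rep_eq_zero_of_mem_R hden h₁ h₂ hx f

theorem functional_r (hden : ∀ n, den φ s t n ≠ 0) (h₁ : s + t = 2 * μ) (h₂ : s * t = ν)
    (f : ℤ → ℂ) (x : SLq φ) : functional hden h₁ h₂ f (r φ μ ν x) = rep hden x f 0 := rfl

theorem functional_act (hden : ∀ n, den φ s t n ≠ 0) (h₁ : s + t = 2 * μ) (h₂ : s * t = ν)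
    (f : ℤ → ℂ) (y : SLq φ) (v : K φ μ ν) :
    functional hden h₁ h₂ f (act y v) = functional hden h₁ h₂ (rep hden y f) v := by
  obtain ⟨x, rfl⟩ := r_surjective φ μ ν v
  rw [act_r, functional_r, functional_r, map_mul, Module.End.mul_apply]

theorem rep_shift_apply (hden : ∀ n, den φ s t n ≠ 0) {s' : ℂ} (f : ℤ → ℂ) (n : ℤ) :
    rep hden (shift φ s') f n =
      (-t / den φ s t n + s' * (q φ ^ n / den φ s t n)) * f (n + 1) +
      ((q φ ^ n) ^ 2 * s / den φ s t n - s' * (q φ ^ n / den φ s t n)) * f (n - 1) := by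
  have hp := qHalf_ne_zero φ
  have := hden n
  simp only [shift, map_add, map_smul, rep, lift_a, lift_b, LinearMap.add_apply,
    LinearMap.smul_apply, Pi.add_apply, Pi.smul_apply, smul_eq_mul, opA, opB, jacobi_apply]
  field_simp
  ring

/-- At `n`, the operator of the upward shift is exactly `f ↦ f (n + 1)` and that of the downward
shift `f ↦ f (n - 1)`: one coefficient cancels and the other is `1`. Induction must vary `f`, since
the action moves onto it. -/
theorem IsLadder.functional_apply {g : ℤ → K φ μ ν} (h : IsLadder s t g) (h0 : g 0 = r φ μ ν 1)
    (hden : ∀ n, den φ s t n ≠ 0) (h₁ : s + t = 2 * μ) (h₂ : s * t = ν) (n : ℤ) (f : ℤ → ℂ) :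
    functional hden h₁ h₂ f (g n) = f n := by
  have hq := q_ne_zero φ
  induction n generalizing f with
  | zero => rw [h0, functional_r, map_one, Module.End.one_apply]
  | succ n ih =>
    have := hden n
    rw [← h.up, functional_act, ih, rep_shift_apply]
    have e : (q φ ^ (n : ℤ)) ^ 2 * s = den φ s t n + t := by rw [den]; ring
    field_simp
    linear_combination f (n + 1) * e
  | pred n ih =>
    have := hden (-n)
    have hX : q φ ^ (-n : ℤ) ≠ 0 := zpow_ne_zero _ hq
    rw [← h.down, functional_act, ih, rep_shift_apply, zpow_neg _ (-n : ℤ)]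
    have e : (q φ ^ (-n : ℤ)) ^ 2 * s = den φ s t (-n) + t := by rw [den]; ring
    generalize q φ ^ (-n : ℤ) = X at *
    field_simp
    linear_combination f (-n - 1) * e

theorem IsLadder.linearIndependent {g : ℤ → K φ μ ν} (h : IsLadder s t g)
    (h0 : g 0 = r φ μ ν 1) (hden : ∀ n, den φ s t n ≠ 0) (h₁ : s + t = 2 * μ) (h₂ : s * t = ν) :
    LinearIndependent ℂ g := by
  rw [linearIndependent_iff]
  intro l hl
  ext n
  have := congrArg (functional hden h₁ h₂ (Pi.single n 1)) hl
  rw [map_zero, Finsupp.linearCombination_apply, map_finsuppSum] at this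
  simpa [h.functional_apply h0, Pi.single_apply, Finsupp.sum] using this

end Representation

/-! ### Identification with Laurent polynomials and their real forms -/

section Laurent

variable {φ μ ν : ℝ} {s t : ℂ}

theorem comul_T (n : ℤ) : Coalgebra.comul (R := ℂ) (LaurentPolynomial.T n : ℂ[T;T⁻¹]) =
    LaurentPolynomial.T n ⊗ₜ LaurentPolynomial.T n := by
  simp

theorem counit_T (n : ℤ) :
    Coalgebra.counit (R := ℂ) (LaurentPolynomial.T n : ℂ[T;T⁻¹]) = 1 := by
  simp

/-- The ladder through the class of `1` identifies `K_{μν}` with the coalgebra of Laurent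
polynomials. -/
theorem exists_coalgEquiv_laurent (φ : ℝ) {μ ν : ℝ} {s t : ℂ} (h₁ : s + t = 2 * μ)
    (h₂ : s * t = ν) (hst : ∀ n : ℤ, q φ ^ n * s ≠ q φ ^ (-n) * t) :
    ∃ (g : ℤ → K φ μ ν) (e : K φ μ ν ≃ₗc[ℂ] ℂ[T;T⁻¹]), g 0 = r φ μ ν 1 ∧ IsLadder s t g ∧
      Submodule.span ℂ (Set.range g) = ⊤ ∧ ∀ n, e (g n) = LaurentPolynomial.T n := by
  obtain ⟨g, h0, h⟩ := (isWeight_r_one (φ := φ) h₁ h₂).exists_ladder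
  -- The denominator is `qⁿ (qⁿ s - q⁻ⁿ t)`.
  have hden (n : ℤ) : den φ s t n ≠ 0 := by
    have hX : q φ ^ n ≠ 0 := zpow_ne_zero _ (q_ne_zero φ)
    intro h
    refine hst n (mul_left_cancel₀ hX ?_)
    rw [den, sub_eq_zero] at h
    rw [zpow_neg, ← mul_assoc, ← mul_assoc, mul_inv_cancel₀ hX, one_mul, ← h, sq]
  have hspan := h.span_eq_top h0 hst
  let B : Module.Basis ℤ ℂ (K φ μ ν) :=
    .mk (h.linearIndependent h0 hden h₁ h₂) hspan.ge
  have hB (n) : B n = g n := Module.Basis.mk_apply _ _ n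
  let E : K φ μ ν ≃ₗ[ℂ] ℂ[T;T⁻¹] := B.repr ≪≫ₗ (AddMonoidAlgebra.coeffLinearEquiv ℂ).symm
  have hE (n) : E (g n) = LaurentPolynomial.T n := by
    rw [← hB]
    simp [E]
  have hgr := h.isGroupLikeElem (h0 ▸ isGroupLikeElem_r_one)
  let F : K φ μ ν →ₗc[ℂ] ℂ[T;T⁻¹] :=
    { E.toLinearMap with
      counit_comp := B.ext fun n => by
        rw [hB]
        change Coalgebra.counit (R := ℂ) (E (g n)) = _
        rw [hE, counit_T, (hgr n).counit_eq_one]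
      map_comp_comul := B.ext fun n => by
        rw [hB]
        change TensorProduct.map E.toLinearMap E.toLinearMap (Coalgebra.comul (g n)) =
          Coalgebra.comul (R := ℂ) (E (g n))
        rw [hE, comul_T, (hgr n).comul_eq_tmul_self, TensorProduct.map_tmul]
        simp [hE] }
  have hF : Function.Bijective F := E.bijective
  exact ⟨g, CoalgEquiv.ofBijective hF, h0, h, hspan, hE⟩

/-- An antilinear intertwining relation may be checked on a spanning family. -/
theorem intertwines_of_span {A B ι : Type*} [AddCommGroup A] [Module ℂ A] [AddCommGroup B]
    [Module ℂ B] {g : ι → A} (hg : Submodule.span ℂ (Set.range g) = ⊤) (e : A →ₗ[ℂ] B)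
    (σ : A →ₛₗ[starRingEnd ℂ] A) (ρ : B → B) (hadd : ∀ x y, ρ (x + y) = ρ x + ρ y)
    (hsmul : ∀ (z : ℂ) (x), ρ (z • x) = conj z • ρ x) (h : ∀ n, e (σ (g n)) = ρ (e (g n)))
    (x : A) : e (σ x) = ρ (e x) := by
  let ρ' : B →ₛₗ[starRingEnd ℂ] B := { toFun := ρ, map_add' := hadd, map_smul' := hsmul }
  exact LinearMap.congr_fun (LinearMap.ext_on_range (f := e ∘ₛₗ σ) (g := ρ' ∘ₛₗ e) hg h) x

theorem mapRingHom_conj_smul (z : ℂ) (f : ℂ[T;T⁻¹]) :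
    AddMonoidAlgebra.mapRingHom ℤ (starRingEnd ℂ) (z • f) =
      conj z • AddMonoidAlgebra.mapRingHom ℤ (starRingEnd ℂ) f := by
  rw [LaurentPolynomial.smul_eq_C_mul, LaurentPolynomial.smul_eq_C_mul, map_mul]
  congr 1
  exact AddMonoidAlgebra.mapRingHom_single ..

theorem mapRingHom_conj_T (n : ℤ) :
    AddMonoidAlgebra.mapRingHom ℤ (starRingEnd ℂ) (LaurentPolynomial.T n) =
      LaurentPolynomial.T n := by
  rw [LaurentPolynomial.T, AddMonoidAlgebra.mapRingHom_single, map_one]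

theorem τRPlus_T (n : ℤ) : τRPlus (LaurentPolynomial.T n) = LaurentPolynomial.T (-n) := by
  rw [τRPlus, starRPlus, LaurentPolynomial.antipode_T, mapRingHom_conj_T]

theorem τS1_T (n : ℤ) : τS1 (LaurentPolynomial.T n) = LaurentPolynomial.T n := by
  rw [τS1, starS1, LaurentPolynomial.antipode_T, mapRingHom_conj_T, LaurentPolynomial.invert_T,
    neg_neg]

theorem realCoalgIso_τRPlus (φ : ℝ) (h₁ : s + t = 2 * μ) (h₂ : s * t = ν) (hs : conj s = s)
    (ht : conj t = t) (hst : ∀ n : ℤ, q φ ^ n * s ≠ q φ ^ (-n) * t) :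
    RealCoalgIso (τK φ μ ν) τRPlus := by
  obtain ⟨g, e, h0, h, hspan, he⟩ := exists_coalgEquiv_laurent φ h₁ h₂ hst
  refine ⟨e, intertwines_of_span hspan (e : K φ μ ν →ₗ[ℂ] ℂ[T;T⁻¹]) (τK φ μ ν) τRPlus
    (fun x y => ?_) (fun z x => ?_) fun n => ?_⟩
  · simp only [τRPlus, starRPlus, map_add]
  · simp only [τRPlus, starRPlus, map_smul, mapRingHom_conj_smul]
  · rw [h.τK_of_real hs ht (by rw [h0, τK_r_one])]
    exact (he _).trans (by rw [← τRPlus_T, ← he]; rfl)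

theorem realCoalgIso_τS1 (φ : ℝ) (h₁ : s + conj s = 2 * μ) (h₂ : s * conj s = ν)
    (hst : ∀ n : ℤ, q φ ^ n * s ≠ q φ ^ (-n) * conj s) :
    RealCoalgIso (τK φ μ ν) τS1 := by
  obtain ⟨g, e, h0, h, hspan, he⟩ := exists_coalgEquiv_laurent φ h₁ h₂ hst
  refine ⟨e, intertwines_of_span hspan (e : K φ μ ν →ₗ[ℂ] ℂ[T;T⁻¹]) (τK φ μ ν) τS1
    (fun x y => ?_) (fun z x => ?_) fun n => ?_⟩
  · simp only [τS1, starS1, map_add]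
  · simp only [τS1, starS1, map_smul, mapRingHom_conj_smul]
  · rw [h.τK_of_conj_eq (by rw [h0, τK_r_one])]
    exact (he _).trans (by rw [← τS1_T, ← he]; rfl)

end Laurent

/-! ### Excluding weight collisions for the given parameters -/

section Parameters

theorem q_zpow_ne_one {φ : ℝ} (hq : ∀ n : ℕ, 0 < n → q φ ^ n ≠ 1) {n : ℤ} (hn : n ≠ 0) :
    q φ ^ n ≠ 1 := by
  intro h
  refine hq n.natAbs (Int.natAbs_pos.2 hn) ?_
  rcases Int.natAbs_eq n with h' | h' <;> rw [h'] at h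
  · rwa [zpow_natCast] at h
  · rwa [zpow_neg, zpow_natCast, inv_eq_one] at h

theorem realCoalgIso_τRPlus_of_lt {φ μ ν : ℝ} (hq : ∀ n : ℕ, 0 < n → q φ ^ n ≠ 1)
    (hμν : ν < μ ^ 2) : RealCoalgIso (τK φ μ ν) τRPlus := by
  have hpos := Real.sqrt_pos.2 (sub_pos.2 hμν)
  have hsq := Real.sq_sqrt (sub_pos.2 hμν).le
  set w := √(μ ^ 2 - ν)
  have hne := q_ne_zero φ
  -- The real roots of `X² - 2μX + ν`.
  refine realCoalgIso_τRPlus (s := (μ + w : ℝ)) (t := (μ - w : ℝ)) φ (by push_cast; ring) ?_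
    (Complex.conj_ofReal _) (Complex.conj_ofReal _) fun n h => ?_
  · rw [← Complex.ofReal_mul]
    congr 1
    linear_combination -hsq
  · have hnorm (m : ℤ) : ‖q φ ^ m‖ = 1 := by
      rw [norm_zpow, q, Complex.norm_exp_ofReal_mul_I, one_zpow]
    have habs := congrArg norm h
    rw [norm_mul, norm_mul, hnorm, hnorm, one_mul, one_mul, Complex.norm_real, Complex.norm_real,
      Real.norm_eq_abs, Real.norm_eq_abs, abs_eq_abs] at habs
    -- A collision forces `|μ + w| = |μ - w|` with `w > 0`. What remains is `q²ⁿ = -1`, impossible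
    -- for `n = 0` and giving `q⁴ⁿ = 1` otherwise.
    have hμ : μ = 0 := by
      rcases habs with h | h <;> linarith
    rw [hμ, zero_add, zero_sub, Complex.ofReal_neg, mul_neg, ← neg_mul] at h
    have h' := mul_right_cancel₀ (by exact_mod_cast hpos.ne') h
    have h2 : q φ ^ (2 * n) = -1 := by
      rw [two_mul, zpow_add₀ hne]
      nth_rewrite 1 [h']
      rw [neg_mul, ← zpow_add₀ hne, neg_add_cancel, zpow_zero]
    rcases eq_or_ne n 0 with rfl | hn
    · norm_num at h2
    · refine q_zpow_ne_one hq (n := 4 * n) (by omega) ?_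
      rw [show 4 * n = 2 * n + 2 * n by ring, zpow_add₀ hne, h2]
      norm_num

theorem realCoalgIso_τS1_of_cos_sq_ne {φ μ ν θ : ℝ} (hν : 0 < ν) (hμ : μ / √ν = Real.cos θ)
    (hθ : ∀ l : ℤ, Real.cos θ ^ 2 ≠ Real.cos (l * φ) ^ 2) :
    RealCoalgIso (τK φ μ ν) τS1 := by
  have hs : √ν ≠ 0 := (Real.sqrt_pos.2 hν).ne'
  rw [div_eq_iff hs, mul_comm] at hμ
  subst hμ
  refine realCoalgIso_τS1 φ (exp_parameter_add_conj √ν θ) (exp_parameter_mul_conj hν.le θ)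
    fun n h => ?_
  refine hθ n ?_
  have hE (n : ℤ) (θ : ℝ) : q φ ^ n * (√ν * Complex.exp (θ * Complex.I)) =
      √ν * Complex.exp ((θ + n * φ : ℝ) * Complex.I) := by
    rw [q, ← Complex.exp_int_mul, mul_left_comm, ← Complex.exp_add]
    push_cast; ring_nf
  -- A collision says that `qⁿ s = √ν e^{i(θ + nφ)}` is real, so `sin (θ + nφ) = 0`.
  rw [← conj_q_zpow, ← map_mul, hE, eq_comm, Complex.conj_eq_iff_im,
    Complex.im_ofReal_mul, Complex.exp_ofReal_mul_I_im] at h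
  have hsin := (mul_eq_zero.1 h).resolve_left hs
  rw [Real.sin_add] at hsin
  have c₁ := Real.sin_sq_add_cos_sq θ
  have c₂ := Real.sin_sq_add_cos_sq (n * φ)
  have key : (Real.sin θ * Real.cos (n * φ)) ^ 2 = (Real.cos θ * Real.sin (n * φ)) ^ 2 := by
    rw [eq_neg_of_add_eq_zero_left hsin, neg_sq]
  linear_combination -key + Real.cos (n * φ) ^ 2 * c₁ - Real.cos θ ^ 2 * c₂

end Parameters

end QuantumSL2

end

theorem mainTheorem2 (φ : ℝ) (hq : ∀ n : ℕ, 0 < n → QuantumSL2.q φ ^ n ≠ 1) :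
    -- (i), `ℝ_+` type
    (∀ μ ν : ℝ, ν < μ ^ 2 → QuantumSL2.RealCoalgIso (QuantumSL2.τK φ μ ν) QuantumSL2.τRPlus) ∧
    -- (i), `S¹` type
    (∀ μ ν θ : ℝ, 0 < ν → μ / √ν = Real.cos θ →
      (∀ l : ℤ, Real.cos θ ^ 2 ≠ Real.cos (l * φ) ^ 2) → QuantumSL2.RealCoalgIso (QuantumSL2.τK φ μ ν) QuantumSL2.τS1) ∧
    -- (i), special series
    (∀ (μ ν θ μ' ν' θ' : ℝ) (l l' : ℤ),
      0 < ν → μ / √ν = Real.cos θ → Real.cos θ ^ 2 = Real.cos (l * φ) ^ 2 →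
      0 < ν' → μ' / √ν' = Real.cos θ' → Real.cos θ' ^ 2 = Real.cos (l' * φ) ^ 2 →
      QuantumSL2.RealCoalgIso (QuantumSL2.τK φ μ ν) (QuantumSL2.τK φ μ' ν')) ∧
    -- (ii)
    (∀ (μ ν θ μn : ℝ) (n : ℤ),
      0 < ν → μ / √ν = Real.cos θ → μn / √ν = Real.cos (θ + n * φ) →
      ∃ e : QuantumSL2.K φ μ ν ≃ₗc[ℂ] QuantumSL2.K φ μn ν,
        (∀ (x : QuantumSL2.SLq φ) (k : QuantumSL2.K φ μ ν), e (MulOpposite.op x • k) = MulOpposite.op x • e k) ∧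
        ∀ k : QuantumSL2.K φ μ ν, e (QuantumSL2.τK φ μ ν k) = QuantumSL2.τK φ μn ν (e k)) := by
  refine ⟨fun μ ν h => QuantumSL2.realCoalgIso_τRPlus_of_lt hq h,
    fun μ ν θ hν hμ hθ => QuantumSL2.realCoalgIso_τS1_of_cos_sq_ne hν hμ hθ,
    fun μ ν θ μ' ν' θ' l l' hν hμ hθ hν' hμ' hθ' =>
      (QuantumSL2.realCoalgIso_special l hν hμ hθ).trans
        (QuantumSL2.realCoalgIso_special l' hν' hμ' hθ').symm,
    fun μ ν θ μn n hν hμ hμn => ?_⟩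
  have hs : √ν ≠ 0 := (Real.sqrt_pos.2 hν).ne'
  rw [div_eq_iff hs, mul_comm] at hμ hμn
  subst hμ hμn
  exact QuantumSL2.moduleCoalgIso_cos_add_int_mul φ hν.le θ n
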